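/- **Setting.** Let $N\ge 2$ agents each play the same stochastic bandit with $K\ge 2$ arms; arm $l$ gives independent Bernoulli rewards of mean $\mu_l$, where $1>\mu_1>\mu_2\ge\dots\ge\mu_K\ge 0$, and $\Delta_l=\mu_1-\mu_l$. Put $c=\lceil K/N\rceil$. Let $P$ be an $N\times N$ matrix whose rows $P(i,\cdot)$ are probability distributions. Let $(B_t)_{t\ge 0}$ be a non-negative non-decreasing sequence (the communication budget), let $\varepsilon>0$, and put $$A_x=\max\bigl(\min\{t\in\mathbb N: B_t\ge x\},\ \lceil(1+x)^{1+\varepsilon}\rceil\bigr)\quad(x\in\mathbb N=\{0,1,\dots\}),\qquad A_{-1}=0.$$ **Algorithm (synchronous GosInE with UCB-$\alpha$).** Phase $j\ge 0$ consists of the time slots $A_{j-1}+1,\dots,A_j$. With arm numbers read cyclically modulo $K$ in $\{1,\dots,K\}$, agent $i$ has the sticky set $\widehat S^{(i)}$ of the $c$ consecutive arms $(i-1)c+1,\dots,ic$, and $U^{(i)}_0=ic+1$, $L^{(i)}_0=ic+2$. Its playing set in phase $j$ is $S^{(i)}_j=\widehat S^{(i)}\cup\{U^{(i)}_j,L^{(i)}_j\}$.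 In each slot $t$ of phase $j$ it pulls an arm $I^{(i)}_t\in S^{(i)}_j$ maximizing $\widehat\mu^{(i)}_l(t-1)+\sqrt{\alpha\ln t/T^{(i)}_l(t-1)}$ over $l\in S^{(i)}_j$, where $T^{(i)}_l(t)$ and $\widehat\mu^{(i)}_l(t)$ are the number of its pulls of arm $l$ and the empirical mean of its rewards from arm $l$ up to slot $t$ (the index is $+\infty$ if $T^{(i)}_l(t-1)=0$). At the end of phase $j$ it calls an agent $k$ drawn from $P(i,\cdot)$, independently of everything else, and receives an arm $\mathcal O^{(i)}_j$ that $k$ pulled most often in phase $j$ among $S^{(k)}_j$. If $\mathcal O^{(i)}_j\in S^{(i)}_j$, then $U^{(i)}$, $L^{(i)}$ are kept; otherwise $U^{(i)}_{j+1}$ is the arm of $\{U^{(i)}_j,L^{(i)}_j\}$ that $i$ pulled more often in phase $j$, and $L^{(i)}_{j+1}=\mathcal O^{(i)}_j$. Ties are broken arbitrarily. The regret is $R^{(i)}_T=\sum_{t=1}^T(\mu_1-\mu_{I^{(i)}_t})$. **Spreading time.** In the pull rumor process on $P$, node $1$ has a rumor initially; in each round every node $j$ without the rumor calls a node drawn from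 $P(j,\cdot)$, independently of everything else, and has the rumor from the end of the round on if the called node had it at the start of the round. $\tau^{(P)}_{spr}$ is the first round after which all nodes have the rumor. **Assumptions.** (A.1) $P$ is irreducible: for all $i\ne j$ there are $2\le l\le N$ and $k_1=i,\dots,k_l=j$ with $P(k_1,k_2)\cdots P(k_{l-1},k_l)>0$. (A.2) For every $D>0$, $B_t\ge D\log t$ for all large $t$; $A_{\lfloor\lambda x+(1-\lambda)y\rfloor}\le\lambda A_x+(1-\lambda)A_y$ for all $x,y\in\mathbb N$, $\lambda\in[0,1]$; and $\sum_{l\ge 2}A_{2l}/A_{l-1}^3<\infty$. **Theorem.** Assume (A.1), (A.2) and $\alpha>3$, and let every agent run the algorithm. Then for every agent $i$ and every $T\in\mathbb N$ (with $\ln 0:=0$ for $T=0$), $$\mathbb E[R^{(i)}_T]\le\Bigl(\sum_{j=2}^{\min(K,\,c+2)}\frac1{\Delta_j}\Bigr)4\alpha\ln T+\frac K4+g\bigl((A_x)\bigr)+\mathbb E\bigl[A_{2\tau^{(P)}_{spr}}\bigr],$$ where the last two terms may be $+\infty$ and $$g\bigl((A_x)\bigr)=A_{j^*}+\frac{2}{2\alpha-3}\sum_{l\ge\max(1,\,j^*/2-1)}\frac{A_{2l+1}}{A_{l-1}^3},$$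 $$j^*=2\max\Bigl(A^{-1}\Bigl(\bigl(N\tbinom K2(c+1)\bigr)^{\frac1{2\alpha-6}}\Bigr)+1,\ \min\Bigl\{j\in\mathbb N:\ \frac{A_k-A_{k-1}}{2+c}\ge1+\frac{4\alpha\log A_k}{\Delta_2^2}\ \text{ for all }k\ge j\Bigr\}\Bigr),$$ with $A^{-1}(x)=\sup\{y\in\mathbb N:A_y\le x\}$. -/

import Mathlib

open MeasureTheory ProbabilityTheory
open scoped ENNReal

noncomputable section

namespace GosInE

/-! ### Communication times and their standing assumption -/

/-- `A_x = max (min {t ∈ ℕ : B_t ≥ x}) ⌈(1 + x)^(1 + ε)⌉`. -/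
def commTime (B : ℕ → ℝ) (ε : ℝ) (x : ℕ) : ℕ :=
  max (sInf {t : ℕ | (x : ℝ) ≤ B t}) ⌈(1 + (x : ℝ)) ^ (1 + ε)⌉₊

/-- `A_{j-1}`, with the convention `A_{-1} = 0`. -/
def prevTime (A : ℕ → ℕ) : ℕ → ℕ
  | 0 => 0
  | j + 1 => A j

/-- The assumption on the budget `B` and on `ε`: growth faster than every multiple of `log t`,
convexity of `A`, and summability. -/
structure BudgetAssumption (B : ℕ → ℝ) (ε : ℝ) : Prop where
  growth : ∀ D : ℝ, 0 < D → ∃ t₀ : ℕ, ∀ t : ℕ, t₀ ≤ t → D * Real.log t ≤ B t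
  convex : ∀ (x y : ℕ) (r : ℝ), 0 ≤ r → r ≤ 1 →
    (commTime B ε ⌊r * (x : ℝ) + (1 - r) * (y : ℝ)⌋₊ : ℝ)
      ≤ r * (commTime B ε x : ℝ) + (1 - r) * (commTime B ε y : ℝ)
  summable : Summable fun l : {l : ℕ // 2 ≤ l} =>
    (commTime B ε (2 * l.1) : ℝ) / (commTime B ε (l.1 - 1) : ℝ) ^ 3

/-! ### The gossip matrix -/

/-- Every row of `P` is a probability distribution. -/
def IsGossipMatrix {N : ℕ} (P : Matrix (Fin N) (Fin N) ℝ) : Prop :=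
  (∀ i j, 0 ≤ P i j) ∧ ∀ i, ∑ j, P i j = 1

/-- Irreducibility: any two distinct agents are joined by a path `k_1, …, k_l`, `2 ≤ l ≤ N`,
of positive weight. -/
def IsIrreducible {N : ℕ} (P : Matrix (Fin N) (Fin N) ℝ) : Prop :=
  ∀ i j : Fin N, i ≠ j → ∃ (l : ℕ) (k : ℕ → Fin N), 2 ≤ l ∧ l ≤ N ∧ k 1 = i ∧ k l = j ∧
    0 < ∏ n ∈ Finset.Ico 1 l, P (k n) (k (n + 1))

/-! ### The randomness -/

/-- `Z i s` is the agent called by agent `i` in round `s`: all calls are independent, and those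
of agent `i` have law `P(i, ·)`. -/
structure IsCallTable {N : ℕ} {Ω : Type*} [MeasurableSpace Ω] (P : Matrix (Fin N) (Fin N) ℝ)
    (μ : Measure Ω) (Z : Fin N → ℕ → Ω → Fin N) : Prop where
  measurable : ∀ i s, Measurable (Z i s)
  indep : iIndepFun (fun p : Fin N × ℕ => Z p.1 p.2) μ
  law : ∀ i s j, μ {ω | Z i s ω = j} = ENNReal.ofReal (P i j)

/-- `Y i l n` is the reward that agent `i` receives at its pull number `n` (counted from `0`) of
arm `l`: all rewards are independent, and those of arm `l` are Bernoulli with mean `m l`. -/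
structure IsRewardTable {N K : ℕ} {Ω : Type*} [MeasurableSpace Ω] (m : Fin K → ℝ)
    (μ : Measure Ω) (Y : Fin N → Fin K → ℕ → Ω → ℝ) : Prop where
  measurable : ∀ i l n, Measurable (Y i l n)
  indep : iIndepFun (fun p : Fin N × Fin K × ℕ => Y p.1 p.2.1 p.2.2) μ
  law_one : ∀ i l n, μ {ω | Y i l n ω = 1} = ENNReal.ofReal (m l)
  law_zero : ∀ i l n, μ {ω | Y i l n ω = 0} = ENNReal.ofReal (1 - m l)

/-! ### The algorithm

Agents and arms are numbered from `0`, so agent `i` and arm `l` below are agent `i + 1` and arm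
`l + 1` of the usual numbering `1, …, N` and `1, …, K`. -/

/-- `⌈K / N⌉`. -/
def stickySize (N K : ℕ) : ℕ := ⌈(K : ℝ) / (N : ℝ)⌉₊

/-- The sticky set of agent `i`: the `⌈K / N⌉` cyclically consecutive arms starting at
`i ⌈K / N⌉` modulo `K`. -/
def sticky (N K : ℕ) [NeZero K] (i : Fin N) : Finset (Fin K) :=
  (Finset.range (stickySize N K)).image fun r => Fin.ofNat K (i.val * stickySize N K + r)

/-- The playing set: the sticky set together with two further arms. -/
def playSet {N K : ℕ} [NeZero K] (i : Fin N) (u l : Fin K) : Finset (Fin K) :=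
  sticky N K i ∪ {u, l}

/-- The number of times arm `l` is pulled in the slots `1, …, t`, if `I s` is the arm pulled in
slot `s`. -/
def pulls {K : ℕ} (I : ℕ → Fin K) (l : Fin K) (t : ℕ) : ℕ :=
  ((Finset.Icc 1 t).filter fun s => I s = l).card

/-- The number of times arm `l` is pulled in phase `j`, that is in the slots
`A_{j-1} + 1, …, A_j`. -/
def phasePulls {K : ℕ} (A : ℕ → ℕ) (I : ℕ → Fin K) (l : Fin K) (j : ℕ) : ℕ :=
  pulls I l (A j) - pulls I l (prevTime A j)

/-- Empirical mean of the rewards obtained from arm `l` up to and including slot `t`. -/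
def empMean {K : ℕ} (y : Fin K → ℕ → ℝ) (I : ℕ → Fin K) (l : Fin K) (t : ℕ) : ℝ :=
  (∑ n ∈ Finset.range (pulls I l t), y l n) / (pulls I l t : ℝ)

/-- The UCB-`α` index of arm `l` in slot `t ≥ 1`; it is `+∞` for an arm not pulled yet. -/
def ucbIndex {K : ℕ} (α : ℝ) (y : Fin K → ℕ → ℝ) (I : ℕ → Fin K) (l : Fin K) (t : ℕ) : EReal :=
  if pulls I l (t - 1) = 0 then ⊤
  else ((empMean y I l (t - 1) +
    Real.sqrt (α * Real.log t / (pulls I l (t - 1) : ℝ)) : ℝ) : EReal)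

/-- `a` maximizes `f` over the set `S`. -/
def IsArgmax {ι β : Type*} [Preorder β] (S : Finset ι) (f : ι → β) (a : ι) : Prop :=
  a ∈ S ∧ ∀ b ∈ S, f b ≤ f a

/-- One sample path of the synchronous algorithm run by all agents, for the rewards `y` and the
calls `z`; ties in each `argmax` may be broken in any way. Here `I i t` is the arm pulled by
agent `i` in slot `t`, `O i j` is the arm recommended to agent `i` at the end of phase `j`, and
the playing set of agent `i` in phase `j` is its sticky set with `U i j` and `L i j`. -/
structure IsRun {N K : ℕ} [NeZero K] (α : ℝ) (A : ℕ → ℕ) (y : Fin N → Fin K → ℕ → ℝ)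
    (z : Fin N → ℕ → Fin N) (I U L O : Fin N → ℕ → Fin K) : Prop where
  init_U : ∀ i, U i 0 = Fin.ofNat K ((i.val + 1) * stickySize N K)
  init_L : ∀ i, L i 0 = Fin.ofNat K ((i.val + 1) * stickySize N K + 1)
  pull : ∀ i j t, prevTime A j < t → t ≤ A j →
    IsArgmax (playSet i (U i j) (L i j)) (fun l => ucbIndex α (y i) (I i) l t) (I i t)
  recommend : ∀ i j,
    IsArgmax (playSet (z i j) (U (z i j) j) (L (z i j) j))
      (fun l => phasePulls A (I (z i j)) l j) (O i j)
  keep : ∀ i j, O i j ∈ playSet i (U i j) (L i j) →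
    U i (j + 1) = U i j ∧ L i (j + 1) = L i j
  update : ∀ i j, O i j ∉ playSet i (U i j) (L i j) →
    IsArgmax {U i j, L i j} (fun l => phasePulls A (I i) l j) (U i (j + 1)) ∧
      L i (j + 1) = O i j

/-- Gap of arm `l` to arm `0`. -/
def gap {K : ℕ} [NeZero K] (m : Fin K → ℝ) (l : Fin K) : ℝ := m 0 - m l

/-- Regret after `T` slots of an agent that pulls arm `I t` in slot `t`. -/
def regret {K : ℕ} [NeZero K] (m : Fin K → ℝ) (I : ℕ → Fin K) (T : ℕ) : ℝ :=
  ∑ t ∈ Finset.Icc 1 T, (m 0 - m (I t))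

/-! ### Rumor spreading in the pull model -/

/-- The nodes possessing the rumor after `s` rounds, if it starts at node `0` and node `j` calls
node `w j s` in round `s`. -/
def informed {N : ℕ} [NeZero N] (w : Fin N → ℕ → Fin N) : ℕ → Finset (Fin N)
  | 0 => {0}
  | s + 1 => informed w s ∪ Finset.univ.filter fun j => w j s ∈ informed w s

/-- First round after which all nodes possess the rumor (`⊤` if there is none). -/
def spreadTime {N : ℕ} [NeZero N] (w : Fin N → ℕ → Fin N) : ℕ∞ :=
  ⨅ (s : ℕ) (_ : informed w s = Finset.univ), (s : ℕ∞)

/-- The sequence `A` as a function on `ℕ∞`, with value `∞` at `⊤`. -/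
def extendTop (A : ℕ → ℕ) : ℕ∞ → ℝ≥0∞
  | ⊤ => ⊤
  | (n : ℕ) => (A n : ℝ≥0∞)

/-- `E[A_{2τ}]` in `[0, ∞]`, where `τ` is the spreading time for the random calls `W`. -/
def expectedSpread {N : ℕ} [NeZero N] {Ω : Type*} [MeasurableSpace Ω] (A : ℕ → ℕ)
    (μ : Measure Ω) (W : Fin N → ℕ → Ω → Fin N) : ℝ≥0∞ :=
  ∫⁻ ω, extendTop A (2 * spreadTime fun i s => W i s ω) ∂μ

/-! ### The constants of the bound -/

/-- `A⁻¹(x) = sup {y ∈ ℕ : A_y ≤ x}`. -/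
def invTime (A : ℕ → ℕ) (x : ℝ) : ℕ := sSup {y : ℕ | (A y : ℝ) ≤ x}

/-- Phase `j` is long: `(A_j - A_{j-1}) / (2 + ⌈K/N⌉) ≥ 1 + 4 α log(A_j) / Δ²`. -/
def LongPhase (N K : ℕ) (α Δ : ℝ) (A : ℕ → ℕ) (j : ℕ) : Prop :=
  1 + 4 * α * Real.log (A j) / Δ ^ 2
    ≤ ((A j : ℝ) - (prevTime A j : ℝ)) / (2 + (stickySize N K : ℝ))

/-- The threshold `j* = 2 max (A⁻¹((N (K choose 2) (⌈K/N⌉ + 1))^(1/(2α-6))) + 1) j₀`, where `j₀` is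
the least `j` such that every phase from `j` on is long. -/
def jStar (N K : ℕ) (α Δ : ℝ) (A : ℕ → ℕ) : ℕ :=
  2 * max
    (invTime A (((N : ℝ) * (K.choose 2 : ℝ) * ((stickySize N K : ℝ) + 1)) ^ (1 / (2 * α - 6))) + 1)
    (sInf {j : ℕ | ∀ k, j ≤ k → LongPhase N K α Δ A k})

/-- `g(A) = A_{j*} + 2/(2α-3) ∑ A_{2l+1} / A_{l-1}³`, in `[0, ∞]`; the sum is over the integers
`l ≥ j*/2 - 1` with `l ≥ 1`. -/
def gConst (α : ℝ) (A : ℕ → ℕ) (jst : ℕ) : ℝ≥0∞ :=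
  (A jst : ℝ≥0∞) + ENNReal.ofReal (2 / (2 * α - 3)) *
    ∑' l : {l : ℕ // 1 ≤ l ∧ jst / 2 ≤ l + 1},
      (A (2 * l.1 + 1) : ℝ≥0∞) / (A (l.1 - 1) : ℝ≥0∞) ^ 3

end GosInE

end

namespace GosInE

/-! ### Communication times -/

/-! Call a phase bad if, for some agent and some slot of the phase, a mean of rewards deviates
harmfully by at least its UCB radius. In a long phase that is not bad, an agent holding the best arm
pulls every suboptimal arm less often than its average pull count. So it pulls the best arm most,
keeps it and recommends it (`IsRun.argmax_phasePulls_eq_zero`, `IsRun.zero_mem_succ`). Agent `0`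
always holds the best arm in its sticky set. Hence, once all phases are long and none is bad, the
best arm travels at least as fast as a rumor in the pull process driven by the calls. When it has
reached everyone, the playing sets freeze and each agent only pays the UCB regret of at most `c + 1`
suboptimal arms (`IsRun.regret_le`).

Let `J = j*/2`, let `s > J` be the first phase from which on no phase is bad, and let `τ` be the
spreading time of the calls made from `s` on. The cost before freezing is at most `A (s - 1 + τ)`.
Midpoint convexity separates the two times: this is at most half of `A (2 (s - 1)) + A (2 τ)`. Since
`s` is a function of the rewards alone, it is independent of the calls, and `τ` has the law of a
fresh spreading time (`tsum_lintegral_settled_le`). Either `s - 1 = J` or phase `s - 1` is bad, so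
`A (2 (s - 1))` is controlled by `A (2 J)` and a sum over bad phases `j > J`. The expectation of
that sum follows from Hoeffding's inequality and union bounds (`IsRewardTable.measure_badPhase_le`).
The half of `A (2 J)` left over absorbs the one extra pull per suboptimal arm. -/

lemma commTime_zero {B : ℕ → ℝ} (hB : ∀ t, 0 ≤ B t) (ε : ℝ) : commTime B ε 0 = 1 := by
  have : sInf {t : ℕ | ((0 : ℕ) : ℝ) ≤ B t} = 0 := by
    rw [Nat.sInf_eq_zero]
    left
    simpa using hB 0
  simp only [commTime, this]
  simp

lemma rpow_le_commTime (B : ℕ → ℝ) (ε : ℝ) (x : ℕ) :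
    (1 + (x : ℝ)) ^ (1 + ε) ≤ commTime B ε x := by
  refine (Nat.le_ceil _).trans ?_
  exact Nat.cast_le.mpr (le_max_right _ _)

lemma lt_commTime (B : ℕ → ℝ) {ε : ℝ} (hε : 0 ≤ ε) (x : ℕ) : x < commTime B ε x := by
  have h1 : (1 + (x : ℝ)) ≤ (1 + (x : ℝ)) ^ (1 + ε) := by
    conv_lhs => rw [← Real.rpow_one (1 + (x : ℝ))]
    apply Real.rpow_le_rpow_of_exponent_le <;> linarith [(Nat.cast_nonneg x : (0 : ℝ) ≤ x)]
  have h2 := h1.trans (rpow_le_commTime B ε x)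
  have h3 : ((1 + x : ℕ) : ℝ) ≤ commTime B ε x := by push_cast; exact h2
  have := Nat.cast_le.mp h3
  omega

lemma BudgetAssumption.exists_le {B : ℕ → ℝ} {ε : ℝ} (hB : BudgetAssumption B ε) (x : ℝ) :
    ∃ t, x ≤ B t := by
  obtain ⟨t₀, h⟩ := hB.growth 1 one_pos
  have hlog : Filter.Tendsto (fun t : ℕ => Real.log t) Filter.atTop Filter.atTop :=
    Real.tendsto_log_atTop.comp tendsto_natCast_atTop_atTop
  obtain ⟨t, ht, ht'⟩ := ((hlog.eventually_ge_atTop x).and (Filter.eventually_ge_atTop t₀)).exists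
  refine ⟨t, ht.trans ?_⟩
  simpa using h t ht'

lemma BudgetAssumption.monotone {B : ℕ → ℝ} {ε : ℝ} (hε : 0 ≤ ε) (hB : BudgetAssumption B ε) :
    Monotone (commTime B ε) := by
  intro x y hxy
  have hxy' : (x : ℝ) ≤ y := by exact_mod_cast hxy
  refine max_le_max ?_ (Nat.ceil_mono ?_)
  · have hne : {t : ℕ | (y : ℝ) ≤ B t}.Nonempty := hB.exists_le y
    exact Nat.sInf_le (hxy'.trans (Nat.sInf_mem hne))
  · have := (Nat.cast_nonneg x : (0 : ℝ) ≤ x)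
    apply Real.rpow_le_rpow <;> linarith

/-- Convexity at the midpoint of even arguments, where the floor is exact. This is what decouples
the last bad phase from the spreading time. -/
lemma BudgetAssumption.two_mul_add_le {B : ℕ → ℝ} {ε : ℝ} (hB : BudgetAssumption B ε)
    (a b : ℕ) :
    2 * commTime B ε (a + b) ≤ commTime B ε (2 * a) + commTime B ε (2 * b) := by
  have h := hB.convex (2 * a) (2 * b) (1 / 2) (by norm_num) (by norm_num)
  have e : (1 / 2 : ℝ) * ((2 * a : ℕ) : ℝ) + (1 - 1 / 2) * ((2 * b : ℕ) : ℝ) = ((a + b : ℕ) : ℝ) := by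
    push_cast; ring
  rw [e, Nat.floor_natCast] at h
  have : (2 * commTime B ε (a + b) : ℝ) ≤ commTime B ε (2 * a) + commTime B ε (2 * b) := by
    linarith
  exact_mod_cast this

lemma BudgetAssumption.two_mul_succ_le {B : ℕ → ℝ} {ε : ℝ} (hB : BudgetAssumption B ε) (k : ℕ) :
    2 * (commTime B ε (k + 1) : ℝ) ≤ commTime B ε (k + 2) + commTime B ε k := by
  have h := hB.convex (k + 2) k (1 / 2) (by norm_num) (by norm_num)
  have e : (1 / 2 : ℝ) * ((k + 2 : ℕ) : ℝ) + (1 - 1 / 2) * (k : ℝ) = ((k + 1 : ℕ) : ℝ) := by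
    push_cast; ring
  rw [e, Nat.floor_natCast] at h
  linarith

/-- A sequence with nondecreasing increments has its last increment above the average. -/
lemma sub_le_mul_sub_of_convex {f : ℕ → ℝ} (h : ∀ k, 2 * f (k + 1) ≤ f (k + 2) + f k) (k : ℕ) :
    f (k + 1) - f 0 ≤ (k + 1) * (f (k + 1) - f k) := by
  induction k with
  | zero => simp
  | succ k ih =>
    have := h k
    push_cast
    have h2 : f (k + 1) - f k ≤ f (k + 2) - f (k + 1) := by linarith
    have h3 : (k + 1 : ℝ) * (f (k + 1) - f k) ≤ (k + 1) * (f (k + 2) - f (k + 1)) := by gcongr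
    have e : k + 1 + 1 = k + 2 := rfl
    rw [e]
    linarith

/-- The right side grows like `x ^ (1 - β)`, a positive power, which dominates the logarithm. -/
lemma eventually_log_le_div_rpow (b C : ℝ) {β : ℝ} (hβ : β < 1) :
    ∀ᶠ x : ℝ in Filter.atTop, b * (1 + C * Real.log x) ≤ (x - 1) / x ^ β := by
  have hr : 0 < 1 - β := by linarith
  have h1 := (isLittleO_log_rpow_atTop hr)
  have h2 : (fun x : ℝ => b * (1 + C * Real.log x)) =o[Filter.atTop] fun x : ℝ => x ^ (1 - β) := by
    apply Asymptotics.IsLittleO.const_mul_left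
    apply Asymptotics.IsLittleO.add
    · rw [Asymptotics.isLittleO_const_left]
      right
      exact tendsto_norm_atTop_atTop.comp (tendsto_rpow_atTop hr)
    · exact h1.const_mul_left C
  have h3 := h2.bound (show (0 : ℝ) < 1 / 2 by norm_num)
  filter_upwards [h3, Filter.eventually_ge_atTop 2] with x hx hx2
  have hx0 : 0 < x := by linarith
  rw [Real.norm_of_nonneg (Real.rpow_nonneg hx0.le _)] at hx
  refine (le_abs_self _).trans (hx.trans ?_)
  rw [le_div_iff₀ (Real.rpow_pos_of_pos hx0 _), mul_assoc, ← Real.rpow_add hx0]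
  simp
  linarith

/-- By convexity the last increment of `A` is at least the average one, `(A k - 1) / k`, and `k` is
at most `A k ^ (1 / (1 + ε))`. So the phase length exceeds a positive power of `A k`, up to a
constant. This makes the `sInf` in `jStar` an attained minimum rather than the default `0`. -/
lemma BudgetAssumption.exists_forall_longPhase {B : ℕ → ℝ} {ε : ℝ} (hε : 0 < ε)
    (hB0 : ∀ t, 0 ≤ B t) (hB : BudgetAssumption B ε) (N K : ℕ) (α Δ : ℝ) :
    ∃ j, ∀ k, j ≤ k → LongPhase N K α Δ (commTime B ε) k := by
  have hβ : 1 / (1 + ε) < 1 := by rw [div_lt_one] <;> linarith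
  have h := eventually_log_le_div_rpow (2 + (stickySize N K : ℝ)) (4 * α / Δ ^ 2) hβ
  have hA : Filter.Tendsto (fun k : ℕ => (commTime B ε k : ℝ)) Filter.atTop Filter.atTop := by
    refine Filter.tendsto_atTop_mono (fun k => ?_) tendsto_natCast_atTop_atTop
    exact_mod_cast (lt_commTime B hε.le k).le
  obtain ⟨j, hj⟩ := Filter.eventually_atTop.mp (hA.eventually h)
  -- Starting at `j + 1` keeps `k` positive, so that the previous phase ends at `A (k - 1)`.
  refine ⟨j + 1, fun k hk => ?_⟩
  obtain ⟨k, rfl⟩ : ∃ k', k = k' + 1 := ⟨k - 1, by omega⟩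
  have h1 := hj (k + 1) (by omega)
  set a : ℝ := (commTime B ε (k + 1) : ℝ) with ha
  have hc := sub_le_mul_sub_of_convex (f := fun k => (commTime B ε k : ℝ)) hB.two_mul_succ_le k
  simp only [commTime_zero hB0, Nat.cast_one] at hc
  have hpos : (0 : ℝ) < k + 1 := by positivity
  have h2 : (k + 1 : ℝ) ≤ a ^ (1 / (1 + ε)) := by
    have h3 := rpow_le_commTime B ε (k + 1)
    have h4 := Real.rpow_le_rpow (by positivity) h3 (show 0 ≤ 1 / (1 + ε) by positivity)
    rw [← Real.rpow_mul (by positivity), mul_one_div_cancel (by positivity), Real.rpow_one] at h4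
    push_cast at h4
    linarith
  have ha1 : 1 ≤ a := by
    have := lt_commTime B hε.le (k + 1)
    rw [ha]; exact_mod_cast (by omega : 1 ≤ commTime B ε (k + 1))
  have h5 : (a - 1) / a ^ (1 / (1 + ε)) ≤ a - commTime B ε k := by
    refine (div_le_div_of_nonneg_left (by linarith) hpos h2).trans ?_
    rw [div_le_iff₀ hpos]
    linarith
  unfold LongPhase
  rw [le_div_iff₀ (by positivity)]
  simp only [prevTime]
  refine le_trans (le_of_eq ?_) (h1.trans h5)
  rw [ha]
  ring

/-! ### The inverse of `A` and the location of slots in phases -/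

lemma lt_invTime {A : ℕ → ℕ} (hA : ∀ j, j < A j) {x : ℝ} {y : ℕ} (hy : invTime A x < y) :
    x < A y := by
  by_contra! h
  -- Boundedness matters: `sSup` of an unbounded set of naturals would be `0`.
  have hb : BddAbove {y : ℕ | (A y : ℝ) ≤ x} := by
    refine ⟨⌊x⌋₊, fun z hz => ?_⟩
    have : (z : ℝ) ≤ x := le_trans (by exact_mod_cast (hA z).le) hz
    exact Nat.le_floor this
  exact absurd (le_csSup hb h) (not_le.mpr hy)

lemma prevTime_le {A : ℕ → ℕ} (hA : Monotone A) (j : ℕ) : prevTime A j ≤ A j := by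
  cases j with
  | zero => exact Nat.zero_le _
  | succ j => exact hA (Nat.le_succ j)

/-- Every slot after the end of phase `s - 1` belongs to a phase from `s` on. -/
lemma exists_phase {A : ℕ → ℕ} (hA : Monotone A) (hA' : ∀ j, j < A j) {s t : ℕ}
    (ht : prevTime A s < t) : ∃ j, s ≤ j ∧ prevTime A j < t ∧ t ≤ A j := by
  have hex : ∃ j, t ≤ A j := ⟨t, (hA' t).le⟩
  classical
  refine ⟨Nat.find hex, ?_, ?_, Nat.find_spec hex⟩
  · by_contra! h
    obtain ⟨s, rfl⟩ : ∃ s', s = s' + 1 := ⟨s - 1, by omega⟩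
    have h1 := Nat.find_spec hex
    have h2 := hA (Nat.lt_succ_iff.mp h)
    simp only [prevTime] at ht
    omega
  · rcases h : Nat.find hex with _ | k
    · exact (Nat.zero_le _).trans_lt ht
    · have := Nat.find_min hex (m := k) (by omega)
      simpa [prevTime] using this

/-! ### Deviations of the empirical means and the UCB rule -/

/-- The direction in which a deviation of the empirical mean of an arm is harmful: downwards for
the best arm `0`, upwards for the others. -/
noncomputable def armSign {K : ℕ} [NeZero K] (l : Fin K) : ℝ := if l = 0 then -1 else 1

/-- For some arm, the mean of at most `t` first rewards `y` deviates harmfully from `m` by at least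
the UCB confidence radius of slot `t`. -/
def Deviates {K : ℕ} [NeZero K] (α : ℝ) (m : Fin K → ℝ) (y : Fin K → ℕ → ℝ) (t : ℕ) : Prop :=
  ∃ l n, 1 ≤ n ∧ n ≤ t ∧
    (n : ℝ) * √(α * Real.log t / n) ≤ ∑ r ∈ Finset.range n, armSign l * (y l r - m l)

/-- Some agent has a harmful deviation in phase `j`. -/
def BadPhase {N K : ℕ} [NeZero K] (α : ℝ) (A : ℕ → ℕ) (m : Fin K → ℝ)
    (y : Fin N → Fin K → ℕ → ℝ) (j : ℕ) : Prop :=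
  ∃ t, prevTime A j < t ∧ t ≤ A j ∧ ∃ i, Deviates α m (y i) t

lemma pulls_succ {K : ℕ} (I : ℕ → Fin K) (l : Fin K) (t : ℕ) :
    pulls I l (t + 1) = pulls I l t + if I (t + 1) = l then 1 else 0 := by
  unfold pulls
  rw [← Finset.insert_Icc_right_eq_Icc_add_one (by omega), Finset.filter_insert]
  split_ifs with h
  · rw [Finset.card_insert_of_notMem (by simp)]
  · rfl

lemma pulls_mono {K : ℕ} (I : ℕ → Fin K) (l : Fin K) : Monotone (pulls I l) := by
  refine monotone_nat_of_le_succ fun t => ?_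
  rw [pulls_succ]
  omega

lemma pulls_le {K : ℕ} (I : ℕ → Fin K) (l : Fin K) (t : ℕ) : pulls I l t ≤ t := by
  refine (Finset.card_filter_le _ _).trans ?_
  simp

/-- If an arm is pulled in the slots after `s` only while its number of pulls is below `x`, then
it is not pulled after `s` or it is pulled less than `x + 1` times altogether. -/
lemma pulls_eq_or_lt {K : ℕ} {I : ℕ → Fin K} {l : Fin K} {x : ℝ} {s T : ℕ} (hsT : s ≤ T)
    (h : ∀ t, s < t → t ≤ T → I t = l → (pulls I l (t - 1) : ℝ) < x) :
    pulls I l T = pulls I l s ∨ (pulls I l T : ℝ) < x + 1 := by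
  induction T, hsT using Nat.le_induction with
  | base => exact Or.inl rfl
  | succ T hT ih =>
    specialize ih fun t h1 h2 => h t h1 (by omega)
    rw [pulls_succ]
    split_ifs with hI
    · right
      have := h (T + 1) (by omega) le_rfl hI
      simp only [Nat.add_sub_cancel] at this
      push_cast
      linarith
    · simpa using ih

/-- The condition `0 ≤ x` covers an arm not pulled after `s`; otherwise already the total count is
small. -/
lemma pulls_sub_lt {K : ℕ} {I : ℕ → Fin K} {l : Fin K} {x : ℝ} (hx : 0 ≤ x) {s T : ℕ}
    (hsT : s ≤ T)
    (h : ∀ t, s < t → t ≤ T → I t = l → (pulls I l (t - 1) : ℝ) < x) :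
    ((pulls I l T - pulls I l s : ℕ) : ℝ) < x + 1 := by
  rcases pulls_eq_or_lt hsT h with h | h
  · rw [h]; simp; linarith
  · refine lt_of_le_of_lt ?_ h
    exact_mod_cast Nat.sub_le _ _

lemma gap_pos {K : ℕ} [NeZero K] {m : Fin K → ℝ} (h : ∀ l, l ≠ 0 → m l < m 0) {l : Fin K}
    (hl : l ≠ 0) : 0 < gap m l := sub_pos.mpr (h l hl)

/-- Without a harmful deviation, UCB pulls a suboptimal arm only if that arm has few pulls. -/
lemma pulls_lt_of_not_deviates {K : ℕ} [NeZero K] {α : ℝ} (hα : 0 < α) {m : Fin K → ℝ}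
    {y : Fin K → ℕ → ℝ} {I : ℕ → Fin K} {S : Finset (Fin K)} {t : ℕ} (ht : 2 ≤ t)
    (h0 : 0 ∈ S) (hI : IsArgmax S (fun l => ucbIndex α y I l t) (I t))
    {a : Fin K} (ha : a ≠ 0) (hgap : 0 < gap m a) (hIa : I t = a) (hd : ¬ Deviates α m y t) :
    (pulls I a (t - 1) : ℝ) < 4 * α * Real.log t / gap m a ^ 2 := by
  have hlog : 0 < Real.log t := Real.log_pos (by exact_mod_cast ht)
  by_contra! hge
  have hmean : ∀ l : Fin K, pulls I l (t - 1) ≠ 0 →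
      armSign l * (empMean y I l (t - 1) - m l) < √(α * Real.log t / (pulls I l (t - 1) : ℝ)) := by
    intro l hl
    by_contra! hdev
    refine hd ⟨l, pulls I l (t - 1), by omega, (pulls_le I l _).trans (by omega), ?_⟩
    have hn : (0 : ℝ) < pulls I l (t - 1) := by exact_mod_cast Nat.pos_of_ne_zero hl
    refine (mul_le_mul_of_nonneg_left hdev hn.le).trans (le_of_eq ?_)
    rw [← Finset.mul_sum, Finset.sum_sub_distrib, empMean]
    simp only [Finset.sum_const, Finset.card_range, nsmul_eq_mul]
    field_simp
  have hna : (0 : ℝ) < pulls I a (t - 1) := lt_of_lt_of_le (by positivity) hge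
  have hna' : pulls I a (t - 1) ≠ 0 := by
    intro h
    simp [h] at hna
  have hle := hI.2 0 h0
  simp only [hIa] at hle
  unfold ucbIndex at hle
  rw [if_neg hna'] at hle
  -- An unpulled best arm would have index `⊤` and beat the finite index of `a`.
  have hn0 : pulls I 0 (t - 1) ≠ 0 := by
    intro h
    rw [if_pos h] at hle
    exact absurd hle (not_le.mpr (EReal.coe_lt_top _))
  rw [if_neg hn0, EReal.coe_le_coe_iff] at hle
  have h1 := hmean 0 hn0
  have h2 := hmean a hna'
  simp only [armSign, if_neg ha, if_true] at h1 h2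
  -- With this many pulls the radius is at most half the gap. The index of `a` is then below `m 0`,
  -- while that of arm `0` is above `m 0`.
  have h3 : √(α * Real.log t / (pulls I a (t - 1) : ℝ)) ≤ gap m a / 2 := by
    rw [Real.sqrt_le_left (by positivity), div_le_iff₀ hna]
    rw [div_le_iff₀ (by positivity)] at hge
    nlinarith
  unfold gap at h3
  linarith

/-! ### Phases of a run -/

lemma card_playSet_le {N K : ℕ} [NeZero K] (i : Fin N) (u l : Fin K) :
    (playSet i u l).card ≤ stickySize N K + 2 := by
  refine (Finset.card_union_le _ _).trans (add_le_add ?_ Finset.card_le_two)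
  exact Finset.card_image_le.trans (by simp)

lemma card_filter_eq_phasePulls {K : ℕ} {I : ℕ → Fin K} {l : Fin K} {s t : ℕ} (h : s ≤ t) :
    ((Finset.Ioc s t).filter fun r => I r = l).card = pulls I l t - pulls I l s := by
  induction t, h using Nat.le_induction with
  | base => simp
  | succ t ht ih =>
    rw [pulls_succ, ← Finset.insert_Ioc_right_eq_Ioc_add_one (by omega), Finset.filter_insert]
    have := pulls_mono I l ht
    split_ifs with hI
    · rw [Finset.card_insert_of_notMem (by simp), ih]
      omega
    · rw [ih]; omega

lemma sum_phasePulls {K : ℕ} {A : ℕ → ℕ} (hA : Monotone A) {I : ℕ → Fin K} {S : Finset (Fin K)}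
    {j : ℕ} (h : ∀ t, prevTime A j < t → t ≤ A j → I t ∈ S) :
    ∑ l ∈ S, phasePulls A I l j = A j - prevTime A j := by
  unfold phasePulls
  simp_rw [← card_filter_eq_phasePulls (prevTime_le hA j)]
  rw [← Finset.card_eq_sum_card_fiberwise (f := I)]
  · simp
  · intro t ht
    simp only [Finset.coe_Ioc, Set.mem_Ioc] at ht
    exact h t ht.1 ht.2

section Run

variable {N K : ℕ} [NeZero K] {α : ℝ} {A : ℕ → ℕ} {y : Fin N → Fin K → ℕ → ℝ}
  {z : Fin N → ℕ → Fin N} {I U L O : Fin N → ℕ → Fin K}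

/-- In a long phase without deviations, an agent that may play arm `0` pulls it strictly more often
than every other arm. -/
lemma IsRun.argmax_phasePulls_eq_zero (hα : 0 < α) (hA : Monotone A) {m : Fin K → ℝ}
    (hm : ∀ l, l ≠ 0 → m l < m 0) {Δ : ℝ} (hΔ : 0 < Δ) (hΔ' : ∀ l, l ≠ 0 → Δ ≤ gap m l)
    (hrun : IsRun α A y z I U L O) {j : ℕ} (hj : 1 ≤ prevTime A j)
    (hlong : LongPhase N K α Δ A j) (hgood : ¬ BadPhase α A m y j) {i : Fin N}
    (h0 : 0 ∈ playSet i (U i j) (L i j)) {a : Fin K}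
    (ha : IsArgmax (playSet i (U i j) (L i j)) (fun l => phasePulls A (I i) l j) a) : a = 0 := by
  by_contra hne
  set S := playSet i (U i j) (L i j)
  have hAj : prevTime A j ≤ A j := prevTime_le hA j
  have hlogA : 0 ≤ Real.log (A j) := Real.log_natCast_nonneg _
  have hlt : (phasePulls A (I i) a j : ℝ) < 4 * α * Real.log (A j) / Δ ^ 2 + 1 := by
    refine pulls_sub_lt (by positivity) hAj fun t ht1 ht2 hIt => ?_
    have hg := gap_pos hm hne
    refine (pulls_lt_of_not_deviates hα (by omega) h0 (hrun.pull i j t ht1 ht2) hne hg hIt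
      fun hd => hgood ⟨t, ht1, ht2, i, hd⟩).trans_le ?_
    have h1 : Real.log t ≤ Real.log (A j) :=
      Real.log_le_log (by exact_mod_cast (by omega : 0 < t)) (by exact_mod_cast ht2)
    have h2 := hΔ' a hne
    gcongr
  have hsum := sum_phasePulls (I := I i) (S := S) hA fun t h1 h2 => (hrun.pull i j t h1 h2).1
  -- A most pulled arm receives at least the average over at most `c + 2` arms; in a long phase this
  -- average is too large for a suboptimal arm.
  have hle : ∑ l ∈ S, phasePulls A (I i) l j ≤ S.card * phasePulls A (I i) a j := by
    rw [← smul_eq_mul]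
    exact Finset.sum_le_card_nsmul _ _ _ ha.2
  have hcard : S.card ≤ stickySize N K + 2 := card_playSet_le _ _ _
  have h3 : A j - prevTime A j ≤ (stickySize N K + 2) * phasePulls A (I i) a j :=
    hsum ▸ hle.trans (Nat.mul_le_mul_right _ hcard)
  have h4 : (A j : ℝ) - prevTime A j ≤ (stickySize N K + 2) * (phasePulls A (I i) a j : ℝ) := by
    rw [← Nat.cast_sub hAj]
    exact_mod_cast h3
  unfold LongPhase at hlong
  rw [le_div_iff₀ (by positivity)] at hlong
  have hc : (0 : ℝ) < stickySize N K + 2 := by positivity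
  nlinarith

variable {m : Fin K → ℝ} {Δ : ℝ}

/-- In a long phase without deviations, agents that may play arm `0` keep it, and so do agents
that call one of them. -/
lemma IsRun.zero_mem_succ (hα : 0 < α) (hA : Monotone A)
    (hm : ∀ l, l ≠ 0 → m l < m 0) (hΔ : 0 < Δ) (hΔ' : ∀ l, l ≠ 0 → Δ ≤ gap m l)
    (hrun : IsRun α A y z I U L O) {j : ℕ} (hj : 1 ≤ prevTime A j)
    (hlong : LongPhase N K α Δ A j) (hgood : ¬ BadPhase α A m y j) {i : Fin N}
    (h : 0 ∈ playSet i (U i j) (L i j) ∨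
      0 ∈ playSet (z i j) (U (z i j) j) (L (z i j) j)) :
    0 ∈ playSet i (U i (j + 1)) (L i (j + 1)) := by
  by_cases h0 : 0 ∈ playSet i (U i j) (L i j)
  · by_cases hO : O i j ∈ playSet i (U i j) (L i j)
    · obtain ⟨hU, hL⟩ := hrun.keep i j hO
      rwa [hU, hL]
    · obtain ⟨hU, hL⟩ := hrun.update i j hO
      simp only [playSet, Finset.mem_union] at h0 ⊢
      rcases h0 with h0 | h0
      · exact Or.inl h0
      right
      have hU0 : U i (j + 1) = 0 := by
        refine hrun.argmax_phasePulls_eq_zero hα hA hm hΔ hΔ' hj hlong hgood (i := i)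
          (Finset.mem_union_right _ h0) ⟨Finset.mem_union_right _ hU.1, ?_⟩
        -- The update maximizes over the pair only. The maximizer over the whole playing set is arm
        -- `0`, which lies in the pair, so both maxima agree.
        obtain ⟨b, hb, hbmax⟩ := Finset.exists_max_image (playSet i (U i j) (L i j))
          (fun l => phasePulls A (I i) l j) ⟨0, Finset.mem_union_right _ h0⟩
        have hb0 := hrun.argmax_phasePulls_eq_zero hα hA hm hΔ hΔ' hj hlong hgood (i := i)
          (Finset.mem_union_right _ h0) ⟨hb, hbmax⟩
        subst hb0
        exact fun l hl => (hbmax l hl).trans (hU.2 0 h0)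
      simp [hU0]
  · have hz := h.resolve_left h0
    -- The called agent recommends arm `0`, which is new to agent `i` and thus enters as `L`.
    have hO : O i j = 0 :=
      hrun.argmax_phasePulls_eq_zero hα hA hm hΔ hΔ' hj hlong hgood hz (hrun.recommend i j)
    obtain ⟨-, hL⟩ := hrun.update i j (hO ▸ h0)
    simp [playSet, hL, hO]

lemma zero_mem_sticky (hK : 1 ≤ K) [NeZero N] : (0 : Fin K) ∈ sticky N K 0 := by
  simp only [sticky, Finset.mem_image, Finset.mem_range]
  refine ⟨0, ?_, ?_⟩
  · unfold stickySize
    rw [Nat.ceil_pos]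
    have : (0 : ℝ) < K := by exact_mod_cast hK
    have : (0 : ℝ) < N := by exact_mod_cast Nat.pos_of_ne_zero (NeZero.ne N)
    positivity
  · simp

/-- Induction over rounds: the source `0` owns the best arm as a sticky arm, and each round of the
rumor process is matched by one phase. -/
lemma IsRun.zero_mem_of_mem_informed [NeZero N] (hα : 0 < α) (hA : Monotone A)
    (hm : ∀ l, l ≠ 0 → m l < m 0) (hΔ : 0 < Δ) (hΔ' : ∀ l, l ≠ 0 → Δ ≤ gap m l)
    (hrun : IsRun α A y z I U L O) {s : ℕ} (hs : ∀ j, s ≤ j → 1 ≤ prevTime A j)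
    (hlong : ∀ j, s ≤ j → LongPhase N K α Δ A j) (hgood : ∀ j, s ≤ j → ¬ BadPhase α A m y j)
    (n : ℕ) {i : Fin N} (hi : i ∈ informed (fun i r => z i (s + r)) n) :
    0 ∈ playSet i (U i (s + n)) (L i (s + n)) := by
  induction n generalizing i with
  | zero =>
    simp only [informed, Finset.mem_singleton] at hi
    subst hi
    exact Finset.mem_union_left _ (zero_mem_sticky (Nat.pos_of_ne_zero (NeZero.ne K)))
  | succ n ih =>
    simp only [informed, Finset.mem_union, Finset.mem_filter, Finset.mem_univ, true_and] at hi
    have hj : s ≤ s + n := Nat.le_add_right _ _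
    exact hrun.zero_mem_succ hα hA hm hΔ hΔ' (hs _ hj) (hlong _ hj) (hgood _ hj)
      (hi.imp (fun h => ih h) fun h => ih h)

/-- Once all agents may play arm `0` the playing sets do not change any more. -/
lemma IsRun.playSet_eq_of_informed_eq_univ [NeZero N] (hα : 0 < α) (hA : Monotone A)
    (hm : ∀ l, l ≠ 0 → m l < m 0) (hΔ : 0 < Δ) (hΔ' : ∀ l, l ≠ 0 → Δ ≤ gap m l)
    (hrun : IsRun α A y z I U L O) {s : ℕ} (hs : ∀ j, s ≤ j → 1 ≤ prevTime A j)
    (hlong : ∀ j, s ≤ j → LongPhase N K α Δ A j) (hgood : ∀ j, s ≤ j → ¬ BadPhase α A m y j)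
    {n : ℕ} (hn : informed (fun i r => z i (s + r)) n = Finset.univ) (k : ℕ) :
    (∀ i, 0 ∈ playSet i (U i (s + n + k)) (L i (s + n + k))) ∧
      ∀ i, playSet i (U i (s + n + k)) (L i (s + n + k))
        = playSet i (U i (s + n)) (L i (s + n)) := by
  induction k with
  | zero =>
    refine ⟨fun i => ?_, fun i => rfl⟩
    exact hrun.zero_mem_of_mem_informed hα hA hm hΔ hΔ' hs hlong hgood n (hn ▸ Finset.mem_univ i)
  | succ k ih =>
    have hj : s ≤ s + n + k := by omega
    have hkeep : ∀ i, playSet i (U i (s + n + k + 1)) (L i (s + n + k + 1))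
        = playSet i (U i (s + n + k)) (L i (s + n + k)) := by
      intro i
      -- All recommendations are now arm `0`, which everyone already has, so nothing is replaced.
      have hO : O i (s + n + k) = 0 :=
        hrun.argmax_phasePulls_eq_zero hα hA hm hΔ hΔ' (hs _ hj) (hlong _ hj) (hgood _ hj)
          (ih.1 _) (hrun.recommend i _)
      obtain ⟨hU, hL⟩ := hrun.keep i _ (hO ▸ ih.1 i)
      rw [hU, hL]
    refine ⟨fun i => ?_, fun i => ?_⟩
    · rw [← add_assoc, hkeep]; exact ih.1 i
    · rw [← add_assoc, hkeep]; exact ih.2 i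

end Run

/-! ### Regret on a sample path -/

lemma gap_nonneg {K : ℕ} [NeZero K] {m : Fin K → ℝ} (hm : Antitone m) (l : Fin K) :
    0 ≤ gap m l := sub_nonneg.mpr (hm (Fin.zero_le l))

lemma gap_le_one {K : ℕ} [NeZero K] {m : Fin K → ℝ} (h0 : ∀ l, 0 ≤ m l) (h1 : ∀ l, m l < 1)
    (l : Fin K) : gap m l ≤ 1 := by
  have := h0 l
  have := h1 0
  unfold gap
  linarith

lemma regret_eq_sum_gap {K : ℕ} [NeZero K] (m : Fin K → ℝ) (I : ℕ → Fin K) (T : ℕ) :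
    regret m I T = ∑ t ∈ Finset.Icc 1 T, gap m (I t) := rfl

lemma regret_le {K : ℕ} [NeZero K] {m : Fin K → ℝ} (h1 : ∀ l, gap m l ≤ 1) (I : ℕ → Fin K)
    (T : ℕ) : regret m I T ≤ T := by
  rw [regret_eq_sum_gap]
  refine (Finset.sum_le_card_nsmul _ _ 1 fun t _ => h1 _).trans ?_
  simp

lemma regret_nonneg {K : ℕ} [NeZero K] {m : Fin K → ℝ} (hm : Antitone m) (I : ℕ → Fin K)
    (T : ℕ) : 0 ≤ regret m I T := by
  rw [regret_eq_sum_gap]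
  exact Finset.sum_nonneg fun t _ => gap_nonneg hm _

/-- Slots up to `s` cost at most `1` each. Afterwards an arm is pulled fewer than `C / gap ^ 2 + 1`
times at cost `gap ≤ 1`, whence the summand. -/
lemma regret_le_add_sum {K : ℕ} [NeZero K] {m : Fin K → ℝ} (h1 : ∀ l, gap m l ≤ 1)
    (hm : ∀ l, l ≠ 0 → m l < m 0) {C : ℝ} (hC : 0 ≤ C)
    {I : ℕ → Fin K} {S : Finset (Fin K)} {s T : ℕ} (hS : ∀ t, s < t → t ≤ T → I t ∈ S)
    (hpull : ∀ t, s < t → t ≤ T → ∀ l, l ≠ 0 → I t = l →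
      (pulls I l (t - 1) : ℝ) < C / gap m l ^ 2) :
    regret m I T ≤ s + ∑ l ∈ S.erase 0, (1 / gap m l * C + 1) := by
  have hnn : ∀ l ∈ S.erase 0, 0 ≤ 1 / gap m l * C + 1 := fun l hl => by
    have := gap_pos hm (Finset.ne_of_mem_erase hl)
    positivity
  rcases le_total T s with hTs | hsT
  · have : (T : ℝ) ≤ s := by exact_mod_cast hTs
    linarith [regret_le h1 I T, Finset.sum_nonneg hnn]
  have hsplit : regret m I T = regret m I s + ∑ t ∈ Finset.Ioc s T, gap m (I t) := by
    rw [regret_eq_sum_gap, regret_eq_sum_gap, ← Finset.sum_union]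
    · congr 1
      ext t
      simp only [Finset.mem_Icc, Finset.mem_union, Finset.mem_Ioc]
      omega
    · rw [Finset.disjoint_left]
      intro t
      simp only [Finset.mem_Icc, Finset.mem_Ioc]
      omega
  rw [hsplit]
  refine add_le_add (regret_le h1 I s) ?_
  rw [← Finset.sum_fiberwise_of_maps_to (s := Finset.Ioc s T) (t := S) (g := I)
    (fun t ht => hS t (Finset.mem_Ioc.mp ht).1 (Finset.mem_Ioc.mp ht).2)]
  have hfib : ∀ l, ∑ t ∈ Finset.Ioc s T with I t = l, gap m (I t)
      = ((pulls I l T - pulls I l s : ℕ) : ℝ) * gap m l := by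
    intro l
    rw [← card_filter_eq_phasePulls hsT, ← nsmul_eq_mul]
    exact Finset.sum_eq_card_nsmul fun t ht => by rw [(Finset.mem_filter.mp ht).2]
  simp_rw [hfib]
  rw [← Finset.sum_erase S (a := 0) (by simp [gap])]
  refine Finset.sum_le_sum fun l hl => ?_
  have hl0 := Finset.ne_of_mem_erase hl
  have hg := gap_pos hm hl0
  have hlt := pulls_sub_lt (I := I) (l := l) (x := C / gap m l ^ 2) (by positivity) hsT
    fun t ht1 ht2 hIt => hpull t ht1 ht2 l hl0 hIt
  calc ((pulls I l T - pulls I l s : ℕ) : ℝ) * gap m l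
      ≤ (C / gap m l ^ 2 + 1) * gap m l := by gcongr
    _ = 1 / gap m l * C + gap m l := by field_simp
    _ ≤ _ := by linarith [h1 l]

/-- Among the sets of at most `c` elements of an initial segment, the first `c` elements have the
largest sum of a nonincreasing nonnegative function. -/
lemma sum_le_sum_first {K : ℕ} [NeZero K] {f : Fin K → ℝ} (hf0 : ∀ l, l ≠ 0 → 0 ≤ f l)
    (hf : ∀ k l, k ≠ 0 → k ≤ l → f l ≤ f k) {c : ℕ} {S : Finset (Fin K)} (hS0 : 0 ∉ S)
    (hS : S.card ≤ c) :
    ∑ l ∈ S, f l ≤ ∑ l : Fin K with 1 ≤ l.val ∧ l.val ≤ c, f l := by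
  set R : Finset (Fin K) := Finset.univ.filter fun l => 1 ≤ l.val ∧ l.val ≤ c with hR
  have hne : ∀ {l : Fin K}, l ≠ 0 ↔ 1 ≤ l.val := fun {l} => by
    rw [Ne, Fin.ext_iff, Fin.val_zero]; omega
  by_cases hsub : S ⊆ R
  · refine Finset.sum_le_sum_of_subset_of_nonneg hsub fun l hl _ => hf0 l ?_
    rw [hne]
    exact (Finset.mem_filter.mp hl).2.1
  obtain ⟨b, hbS, hbR⟩ := Finset.not_subset.mp hsub
  have hb1 : 1 ≤ b.val := hne.mp fun h => hS0 (h ▸ hbS)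
  have hbc : c < b.val := by
    by_contra! h
    exact hbR (by simp [hR, hb1, h])
  have hc : 1 ≤ c := (Finset.card_pos.mpr ⟨b, hbS⟩).trans_le hS
  have hcK : c < K := hbc.trans b.isLt
  have hRcard : R.card = c := by
    have : R.map Fin.valEmbedding = Finset.Icc 1 c := by
      ext x
      simp only [hR, Finset.mem_map, Finset.mem_filter, Finset.mem_univ, true_and,
        Fin.valEmbedding_apply, Finset.mem_Icc]
      constructor
      · rintro ⟨l, hl, rfl⟩; exact hl
      · intro h; exact ⟨⟨x, by omega⟩, h, rfl⟩
    rw [← Finset.card_map Fin.valEmbedding, this]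
    simp
  -- The value at `c` is the pivot: it bounds `f` from above on `S \ R` and from below on `R \ S`,
  -- and `R \ S` has at least as many elements.
  set v := f ⟨c, hcK⟩
  have hcne : (⟨c, hcK⟩ : Fin K) ≠ 0 := hne.mpr hc
  have hv : 0 ≤ v := hf0 _ hcne
  have h1 : ∑ l ∈ S \ R, f l ≤ (S \ R).card * v := by
    rw [← nsmul_eq_mul]
    refine Finset.sum_le_card_nsmul _ _ _ fun l hl => hf _ _ hcne ?_
    obtain ⟨hlS, hlR⟩ := Finset.mem_sdiff.mp hl
    have hl1 : 1 ≤ l.val := hne.mp fun h => hS0 (h ▸ hlS)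
    rw [Fin.le_iff_val_le_val]
    by_contra! h
    exact hlR (by simp only [hR, Finset.mem_filter, Finset.mem_univ, true_and]; exact ⟨hl1, h.le⟩)
  have h2 : ((R \ S).card : ℝ) * v ≤ ∑ l ∈ R \ S, f l := by
    rw [← nsmul_eq_mul]
    refine Finset.card_nsmul_le_sum _ _ _ fun l hl => ?_
    obtain ⟨hlR, -⟩ := Finset.mem_sdiff.mp hl
    obtain ⟨hl1, hlc⟩ := (Finset.mem_filter.mp hlR).2
    exact hf _ _ (hne.mpr hl1) hlc
  have h3 : (S \ R).card ≤ (R \ S).card := by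
    have e1 := Finset.card_sdiff_add_card_inter S R
    have e2 := Finset.card_sdiff_add_card_inter R S
    rw [Finset.inter_comm] at e2
    omega
  have h4 : ((S \ R).card : ℝ) * v ≤ (R \ S).card * v := by gcongr
  rw [← Finset.sum_inter_add_sum_sdiff S R f, ← Finset.sum_inter_add_sum_sdiff R S f,
    Finset.inter_comm R S]
  linarith

lemma one_div_gap_anti {K : ℕ} [NeZero K] {m : Fin K → ℝ} (hanti : Antitone m)
    (hm : ∀ l, l ≠ 0 → m l < m 0) {k l : Fin K} (hk : k ≠ 0) (hkl : k ≤ l) :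
    1 / gap m l ≤ 1 / gap m k := by
  refine one_div_le_one_div_of_le (gap_pos hm hk) ?_
  unfold gap
  linarith [hanti hkl]

/-- If all phases from `s` on are long and free of deviations and the rumor spreads within `n`
rounds of the calls made from phase `s` on, then the regret after phase `s + n - 1` is the one of
UCB on a fixed set of arms. -/
lemma IsRun.regret_le {N K : ℕ} [NeZero N] [NeZero K] {α : ℝ} {A : ℕ → ℕ}
    {y : Fin N → Fin K → ℕ → ℝ} {z : Fin N → ℕ → Fin N} {I U L O : Fin N → ℕ → Fin K}
    {m : Fin K → ℝ} {Δ : ℝ} (hα : 0 < α) (hA : Monotone A) (hA' : ∀ j, j < A j)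
    (h0 : ∀ l, 0 ≤ m l) (h1 : ∀ l, m l < 1) (hanti : Antitone m)
    (hm : ∀ l, l ≠ 0 → m l < m 0) (hΔ : 0 < Δ) (hΔ' : ∀ l, l ≠ 0 → Δ ≤ gap m l)
    (hrun : IsRun α A y z I U L O) {s : ℕ} (hs : 1 ≤ s)
    (hlong : ∀ j, s ≤ j → LongPhase N K α Δ A j) (hgood : ∀ j, s ≤ j → ¬ BadPhase α A m y j)
    {n : ℕ} (hn : informed (fun i r => z i (s + r)) n = Finset.univ) (i : Fin N) (T : ℕ) :
    regret m (I i) T ≤ A (s - 1 + n)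
      + (∑ l : Fin K with 1 ≤ l.val ∧ l.val ≤ stickySize N K + 1, 1 / gap m l)
        * (4 * α * Real.log T) + (stickySize N K + 1) := by
  have hprev : ∀ j, s ≤ j → 1 ≤ prevTime A j := fun j hj => by
    obtain ⟨j, rfl⟩ : ∃ j', j = j' + 1 := ⟨j - 1, by omega⟩
    simp only [prevTime]
    have := hA' j
    omega
  have hset := hrun.playSet_eq_of_informed_eq_univ hα hA hm hΔ hΔ' hprev hlong hgood hn
  set S := playSet i (U i (s + n)) (L i (s + n)) with hS
  have hS0 : 0 ∈ S := (hset 0).1 i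
  -- Phase `s + n` is the first frozen one; the slots before it are paid in full.
  have hAs : prevTime A (s + n) = A (s - 1 + n) := by
    obtain ⟨s, rfl⟩ : ∃ s', s = s' + 1 := ⟨s - 1, by omega⟩
    rw [show s + 1 + n = (s + n) + 1 by ring]
    simp [prevTime]
  have hslot : ∀ t, A (s - 1 + n) < t → IsArgmax S (fun l => ucbIndex α (y i) (I i) l t) (I i t)
      ∧ ¬ Deviates α m (y i) t := by
    intro t ht
    obtain ⟨j, hj, ht1, ht2⟩ := exists_phase hA hA' (s := s + n) (hAs ▸ ht)
    obtain ⟨k, rfl⟩ := Nat.exists_eq_add_of_le hj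
    have := hrun.pull i _ t ht1 ht2
    rw [(hset k).2 i] at this
    exact ⟨this, fun hd => hgood (s + n + k) (by omega) ⟨t, ht1, ht2, i, hd⟩⟩
  have hlogT : 0 ≤ Real.log T := Real.log_natCast_nonneg T
  have hA1 := hA' (s - 1 + n)
  have hreg := regret_le_add_sum (gap_le_one h0 h1) hm (C := 4 * α * Real.log T) (by positivity)
    (I := I i) (S := S) (s := A (s - 1 + n)) (T := T) (fun t ht _ => (hslot t ht).1.1)
    (fun t ht htT l hl hIl => by
      have hg := gap_pos hm hl
      refine (pulls_lt_of_not_deviates hα (by omega) hS0 (hslot t ht).1 hl hg hIl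
        (hslot t ht).2).trans_le ?_
      have : Real.log t ≤ Real.log T :=
        Real.log_le_log (by exact_mod_cast (by omega : 0 < t)) (by exact_mod_cast htT)
      gcongr)
  have hcard : (S.erase 0).card ≤ stickySize N K + 1 := by
    rw [Finset.card_erase_of_mem hS0]
    have : S.card ≤ stickySize N K + 2 := card_playSet_le _ _ _
    omega
  have hsum := sum_le_sum_first (f := fun l => 1 / gap m l)
    (fun l hl => (one_div_pos.mpr (gap_pos hm hl)).le)
    (fun k l hk hkl => one_div_gap_anti hanti hm hk hkl) (S := S.erase 0)
    (Finset.notMem_erase 0 S) hcard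
  rw [Finset.sum_add_distrib, ← Finset.sum_mul] at hreg
  simp only [Finset.sum_const, nsmul_eq_mul, mul_one] at hreg
  have hcard' : ((S.erase 0).card : ℝ) ≤ stickySize N K + 1 := by exact_mod_cast hcard
  have hmul := mul_le_mul_of_nonneg_right hsum (show 0 ≤ 4 * α * Real.log T by positivity)
  linarith

/-! ### Concentration of the rewards -/

section Rewards

variable {N K : ℕ} {Ω : Type*} [MeasurableSpace Ω] {m : Fin K → ℝ} {μ : Measure Ω}
  [IsProbabilityMeasure μ] {Y : Fin N → Fin K → ℕ → Ω → ℝ}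

lemma IsRewardTable.ae_eq_indicator (h0 : ∀ l, 0 ≤ m l) (h1 : ∀ l, m l < 1)
    (hY : IsRewardTable m μ Y) (i : Fin N) (l : Fin K) (n : ℕ) :
    Y i l n =ᵐ[μ] {ω | Y i l n ω = 1}.indicator 1 := by
  have hm1 : MeasurableSet {ω | Y i l n ω = 1} := hY.measurable i l n (measurableSet_singleton 1)
  have hm0 : MeasurableSet {ω | Y i l n ω = 0} := hY.measurable i l n (measurableSet_singleton 0)
  have hdisj : Disjoint {ω | Y i l n ω = 1} {ω | Y i l n ω = 0} := by
    rw [Set.disjoint_left]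
    intro ω h h'
    simp only [Set.mem_ofPred_eq] at h h'
    linarith
  have hu : μ ({ω | Y i l n ω = 1} ∪ {ω | Y i l n ω = 0}) = 1 := by
    rw [measure_union hdisj hm0, hY.law_one, hY.law_zero,
      ← ENNReal.ofReal_add (h0 l) (by linarith [h1 l])]
    simp
  have hae : ∀ᵐ ω ∂μ, ω ∈ {ω | Y i l n ω = 1} ∪ {ω | Y i l n ω = 0} :=
    (mem_ae_iff_prob_eq_one (hm1.union hm0)).mpr hu
  filter_upwards [hae] with ω hω
  rcases hω with hω | hω
  · simp only [Set.mem_ofPred_eq] at hω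
    simp [Set.indicator, hω]
  · simp only [Set.mem_ofPred_eq] at hω
    simp [Set.indicator, hω]

lemma IsRewardTable.integral_eq (h0 : ∀ l, 0 ≤ m l) (h1 : ∀ l, m l < 1)
    (hY : IsRewardTable m μ Y) (i : Fin N) (l : Fin K) (n : ℕ) : ∫ ω, Y i l n ω ∂μ = m l := by
  have hm1 : MeasurableSet {ω | Y i l n ω = 1} := hY.measurable i l n (measurableSet_singleton 1)
  rw [integral_congr_ae (hY.ae_eq_indicator h0 h1 i l n), integral_indicator_one hm1,
    measureReal_def, hY.law_one, ENNReal.toReal_ofReal (h0 l)]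

/-- Hoeffding's lemma on `[0, 1]`, with variance proxy `1 / 4`; the sign for arm `0` is harmless. -/
lemma IsRewardTable.hasSubgaussianMGF [NeZero K] (h0 : ∀ l, 0 ≤ m l) (h1 : ∀ l, m l < 1)
    (hY : IsRewardTable m μ Y) (i : Fin N) (l : Fin K) (n : ℕ) :
    HasSubgaussianMGF (fun ω => armSign l * (Y i l n ω - m l)) ((1 / 2) ^ 2) μ := by
  have h := hasSubgaussianMGF_of_mem_Icc (a := 0) (b := 1) (hY.measurable i l n).aemeasurable
    (by
      filter_upwards [hY.ae_eq_indicator h0 h1 i l n] with ω hω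
      rw [hω]
      by_cases h : ω ∈ {ω | Y i l n ω = 1} <;> simp only [Set.indicator, h] <;> simp)
  rw [hY.integral_eq h0 h1] at h
  simp only [sub_zero, nnnorm_one] at h
  unfold armSign
  split_ifs
  · simpa [Pi.neg_def] using h.neg
  · simpa using h

lemma IsRewardTable.measure_deviation_le [NeZero K] (h0 : ∀ l, 0 ≤ m l) (h1 : ∀ l, m l < 1)
    (hY : IsRewardTable m μ Y) {α : ℝ} (hα : 0 < α) (i : Fin N) (l : Fin K) {n t : ℕ}
    (hn : 1 ≤ n) (ht : 1 ≤ t) :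
    μ {ω | (n : ℝ) * √(α * Real.log t / n)
        ≤ ∑ r ∈ Finset.range n, armSign l * (Y i l r ω - m l)}
      ≤ ENNReal.ofReal ((t : ℝ) ^ (-(2 * α))) := by
  have hind : iIndepFun (fun (r : ℕ) ω => armSign l * (Y i l r ω - m l)) μ := by
    have := hY.indep.precomp (g := fun r : ℕ => (i, l, r)) (fun a b h => by simpa using h)
    exact this.comp (fun _ x => armSign l * (x - m l)) fun _ => by fun_prop
  have hlog : 0 ≤ Real.log t := Real.log_natCast_nonneg t
  have hn0 : (0 : ℝ) < n := by exact_mod_cast hn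
  have ht0 : (0 : ℝ) < t := by exact_mod_cast ht
  have h := HasSubgaussianMGF.measure_sum_range_ge_le_of_iIndepFun hind (c := (1 / 2) ^ 2) (n := n)
    (fun r _ => hY.hasSubgaussianMGF h0 h1 i l r) (ε := n * √(α * Real.log t / n)) (by positivity)
  rw [measureReal_def] at h
  rw [← ENNReal.ofReal_toReal (measure_ne_top μ _)]
  -- The squared threshold is `n * α * log t`; divided by `2 * n / 4` it gives the exponent `-2 * α
  -- * log t`.
  refine ENNReal.ofReal_le_ofReal (h.trans (le_of_eq ?_))
  rw [Real.rpow_def_of_pos ht0, mul_pow, Real.sq_sqrt (by positivity)]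
  congr 1
  push_cast
  field_simp

/-- Union bound over `K` arms and `t` pull counts, the reason for the extra factor `K * t`. -/
lemma IsRewardTable.measure_deviates_le [NeZero K] (h0 : ∀ l, 0 ≤ m l) (h1 : ∀ l, m l < 1)
    (hY : IsRewardTable m μ Y) {α : ℝ} (hα : 0 < α) (i : Fin N) {t : ℕ} (ht : 1 ≤ t) :
    μ {ω | Deviates α m (fun l n => Y i l n ω) t}
      ≤ ENNReal.ofReal (K * (t : ℝ) ^ (1 - 2 * α)) := by
  have ht0 : (0 : ℝ) < t := by exact_mod_cast ht
  have hset : {ω | Deviates α m (fun l n => Y i l n ω) t}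
      ⊆ ⋃ p ∈ (Finset.univ : Finset (Fin K)) ×ˢ Finset.Icc 1 t,
        {ω | (p.2 : ℝ) * √(α * Real.log t / p.2)
          ≤ ∑ r ∈ Finset.range p.2, armSign p.1 * (Y i p.1 r ω - m p.1)} := by
    rintro ω ⟨l, n, hn1, hnt, h⟩
    simp only [Set.mem_iUnion]
    exact ⟨(l, n), by simp [hn1, hnt], h⟩
  refine (measure_mono hset).trans ((measure_biUnion_finset_le _ _).trans ?_)
  refine (Finset.sum_le_sum fun p hp => hY.measure_deviation_le h0 h1 hα i p.1
    (Finset.mem_Icc.mp (Finset.mem_product.mp hp).2).1 ht).trans (le_of_eq ?_)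
  rw [Finset.sum_const, Finset.card_product, Finset.card_univ, Fintype.card_fin, Nat.card_Icc,
    Nat.add_sub_cancel, nsmul_eq_mul, ← ENNReal.ofReal_natCast, ← ENNReal.ofReal_mul (by positivity),
    sub_eq_add_neg 1, Real.rpow_add ht0, Real.rpow_one]
  push_cast
  ring_nf

/-- Bernoulli's inequality for `(1 + 1 / t) ^ p`; a discrete form of integrating `x ^ (-p - 1)`,
made to telescope. -/
lemma rpow_neg_succ_le_sub {p : ℝ} (hp : 1 ≤ p) {t : ℕ} (ht : 1 ≤ t) :
    p * ((t + 1 : ℕ) : ℝ) ^ (-p - 1) ≤ (t : ℝ) ^ (-p) - ((t + 1 : ℕ) : ℝ) ^ (-p) := by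
  have ht0 : (0 : ℝ) < t := by exact_mod_cast ht
  have ht1 : (0 : ℝ) < (t + 1 : ℕ) := by positivity
  have hb := one_add_mul_self_le_rpow_one_add (s := 1 / (t : ℝ)) (by
    have : 0 < 1 / (t : ℝ) := by positivity
    linarith) hp
  have e : 1 + 1 / (t : ℝ) = ((t + 1 : ℕ) : ℝ) / t := by push_cast; field_simp
  rw [e, Real.div_rpow ht1.le ht0.le, le_div_iff₀ (by positivity)] at hb
  rw [Real.rpow_sub ht1, Real.rpow_neg ht1.le, Real.rpow_neg ht0.le, Real.rpow_one]
  set x := (t : ℝ) ^ p with hx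
  set z := ((t + 1 : ℕ) : ℝ) ^ p with hz
  have hx0 : 0 < x := Real.rpow_pos_of_pos ht0 p
  have hz0 : 0 < z := Real.rpow_pos_of_pos ht1 p
  have h1 : p * (z⁻¹ / ((t + 1 : ℕ) : ℝ)) ≤ p * (z⁻¹ / (t : ℝ)) := by
    have : (t : ℝ) ≤ (t + 1 : ℕ) := by push_cast; linarith
    gcongr
  refine h1.trans ?_
  rw [le_sub_iff_add_le]
  have e2 : p * (z⁻¹ / (t : ℝ)) + z⁻¹ = ((1 + p * (1 / (t : ℝ))) * x) * (x⁻¹ * z⁻¹) := by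
    field_simp
    ring
  rw [e2]
  calc _ ≤ z * (x⁻¹ * z⁻¹) := by gcongr
    _ = x⁻¹ := by field_simp

lemma sum_Ioc_rpow_neg_le {p : ℝ} (hp : 1 ≤ p) {a b : ℕ} (ha : 1 ≤ a) :
    p * ∑ t ∈ Finset.Ioc a b, (t : ℝ) ^ (-p - 1) ≤ (a : ℝ) ^ (-p) := by
  rcases le_total b a with hba | hab
  · rw [Finset.Ioc_eq_empty (by omega)]
    simp only [Finset.sum_empty, mul_zero]
    positivity
  · have : p * ∑ t ∈ Finset.Ioc a b, (t : ℝ) ^ (-p - 1) ≤ (a : ℝ) ^ (-p) - (b : ℝ) ^ (-p) := by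
      induction b, hab using Nat.le_induction with
      | base => simp
      | succ b hb ih =>
        rw [← Finset.insert_Ioc_right_eq_Ioc_add_one (by omega),
          Finset.sum_insert (by simp), mul_add]
        have := rpow_neg_succ_le_sub hp (t := b) (by omega)
        linarith
    have h2 : 0 ≤ (b : ℝ) ^ (-p) := by positivity
    linarith

lemma IsRewardTable.measure_badPhase_le [NeZero K] (h0 : ∀ l, 0 ≤ m l) (h1 : ∀ l, m l < 1)
    (hY : IsRewardTable m μ Y) {α : ℝ} (hα : 3 < α) {A : ℕ → ℕ} {j : ℕ} (hj : 1 ≤ prevTime A j) :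
    μ {ω | BadPhase α A m (fun i l n => Y i l n ω) j}
      ≤ ENNReal.ofReal (N * K / (2 * α - 2) * (prevTime A j : ℝ) ^ (2 - 2 * α)) := by
  have hset : {ω | BadPhase α A m (fun i l n => Y i l n ω) j}
      ⊆ ⋃ p ∈ (Finset.univ : Finset (Fin N)) ×ˢ Finset.Ioc (prevTime A j) (A j),
        {ω | Deviates α m (fun l n => Y p.1 l n ω) p.2} := by
    rintro ω ⟨t, ht1, ht2, i, h⟩
    simp only [Set.mem_iUnion]
    exact ⟨(i, t), by simp [ht1, ht2], h⟩
  refine (measure_mono hset).trans ((measure_biUnion_finset_le _ _).trans ?_)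
  refine (Finset.sum_le_sum fun p hp => hY.measure_deviates_le h0 h1 (by linarith) p.1
    (by have := (Finset.mem_Ioc.mp (Finset.mem_product.mp hp).2).1; omega)).trans ?_
  rw [← ENNReal.ofReal_sum_of_nonneg (fun _ _ => by positivity), Finset.sum_product]
  refine ENNReal.ofReal_le_ofReal ?_
  simp only [Finset.sum_const, Finset.card_univ, Fintype.card_fin, nsmul_eq_mul]
  rw [← Finset.mul_sum]
  have hp : (0 : ℝ) < 2 * α - 2 := by linarith
  have h := sum_Ioc_rpow_neg_le (p := 2 * α - 2) (by linarith) (b := A j) hj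
  rw [show -(2 * α - 2) - 1 = 1 - 2 * α by ring, show -(2 * α - 2) = 2 - 2 * α by ring] at h
  rw [mul_comm, ← le_div_iff₀ hp] at h
  calc (N : ℝ) * (K * ∑ t ∈ Finset.Ioc (prevTime A j) (A j), (t : ℝ) ^ (1 - 2 * α))
      ≤ N * (K * ((prevTime A j : ℝ) ^ (2 - 2 * α) / (2 * α - 2))) := by gcongr
    _ = _ := by ring

end Rewards

/-! ### Rumor spreading -/

section Calls

variable {N : ℕ}

lemma measurable_informed [NeZero N] (n : ℕ) :
    Measurable fun w : Fin N × ℕ → Fin N => informed (fun i r => w (i, r)) n := by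
  induction n with
  | zero => exact measurable_const
  | succ n ih =>
    -- Splitting over the finitely many values `R` of the previous round leaves an event about the
    -- calls of round `n` only.
    refine measurable_to_countable' fun S => ?_
    have : (fun w : Fin N × ℕ → Fin N => informed (fun i r => w (i, r)) (n + 1)) ⁻¹' {S}
        = ⋃ R : Finset (Fin N), {w | informed (fun i r => w (i, r)) n = R} ∩
          {w | (R ∪ Finset.univ.filter fun j => w (j, n) ∈ R) = S} := by
      ext w
      simp [informed]
    rw [this]
    refine MeasurableSet.iUnion fun R => (ih (measurableSet_singleton R)).inter ?_
    have hm : Measurable fun w : Fin N × ℕ → Fin N => fun j : Fin N => w (j, n) :=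
      measurable_pi_lambda _ fun j => measurable_pi_apply _
    exact hm (MeasurableSet.of_discrete
      (s := {v : Fin N → Fin N | (R ∪ Finset.univ.filter fun j => v j ∈ R) = S}))

lemma measurable_extendTop_spreadTime [NeZero N] (A : ℕ → ℕ) :
    Measurable fun w : Fin N × ℕ → Fin N =>
      extendTop A (2 * spreadTime fun i r => w (i, r)) := by
  have h : Measurable fun w : Fin N × ℕ → Fin N => spreadTime fun i r => w (i, r) := by
    have : BorelSpace ℕ∞ := ⟨borel_eq_top_of_countable.symm⟩
    unfold spreadTime
    simp_rw [iInf_eq_if]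
    exact Measurable.iInf fun s => Measurable.ite
      (measurable_informed s (measurableSet_singleton Finset.univ)) measurable_const
      measurable_const
  exact (Measurable.of_discrete (f := fun n : ℕ∞ => extendTop A (2 * n))).comp h

/-- The law of a call table does not depend on the round in which it starts. -/
lemma lintegral_shift_eq {P : Matrix (Fin N) (Fin N) ℝ} {Ω Ω' : Type*} [MeasurableSpace Ω]
    [MeasurableSpace Ω'] {μ : Measure Ω} {ν : Measure Ω'} [IsProbabilityMeasure μ]
    [IsProbabilityMeasure ν] {Z : Fin N → ℕ → Ω → Fin N} {W : Fin N → ℕ → Ω' → Fin N}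
    (hZ : IsCallTable P μ Z) (hW : IsCallTable P ν W) (s : ℕ)
    {F : (Fin N × ℕ → Fin N) → ℝ≥0∞} (hF : Measurable F) :
    ∫⁻ ω, F (fun p => Z p.1 (s + p.2) ω) ∂μ = ∫⁻ ω, F (fun p => W p.1 p.2 ω) ∂ν := by
  have hZm : ∀ p : Fin N × ℕ, Measurable (Z p.1 (s + p.2)) := fun p => hZ.measurable _ _
  have hWm : ∀ p : Fin N × ℕ, Measurable (W p.1 p.2) := fun p => hW.measurable _ _
  have hZi : iIndepFun (fun p : Fin N × ℕ => Z p.1 (s + p.2)) μ :=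
    hZ.indep.precomp (g := fun p : Fin N × ℕ => (p.1, s + p.2)) fun a b h => by
      simp only [Prod.mk.injEq, add_right_inj] at h
      exact Prod.ext h.1 h.2
  have hlaw : ∀ p : Fin N × ℕ, μ.map (Z p.1 (s + p.2)) = ν.map (W p.1 p.2) := by
    intro p
    refine Measure.ext_of_singleton fun j => ?_
    rw [Measure.map_apply (hZm p) (measurableSet_singleton j),
      Measure.map_apply (hWm p) (measurableSet_singleton j)]
    exact (hZ.law _ _ j).trans (hW.law _ _ j).symm
  have hmap : μ.map (fun ω (p : Fin N × ℕ) => Z p.1 (s + p.2) ω)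
      = ν.map (fun ω (p : Fin N × ℕ) => W p.1 p.2 ω) := by
    rw [hZi.map_fun_eq_infinitePi_map hZm, hW.indep.map_fun_eq_infinitePi_map hWm]
    simp_rw [hlaw]
  rw [← lintegral_map hF (measurable_pi_lambda _ hZm), hmap,
    lintegral_map hF (measurable_pi_lambda _ hWm)]

end Calls

/-! ### The regret bound on a sample path, in terms of the last phase with a deviation -/

/-- Phase `s` is the first phase after `J` from which on no phase has a harmful deviation. -/
def Settled {N K : ℕ} [NeZero K] (α : ℝ) (A : ℕ → ℕ) (m : Fin K → ℝ) (J : ℕ)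
    (y : Fin N → Fin K → ℕ → ℝ) (s : ℕ) : Prop :=
  J + 1 ≤ s ∧ (∀ j, s ≤ j → ¬ BadPhase α A m y j) ∧ (s = J + 1 ∨ BadPhase α A m y (s - 1))

/-- If one such phase preceded the other, the phase just before the later one would be both bad and
not bad. This makes the events of settling at different phases disjoint. -/
lemma Settled.eq {N K : ℕ} [NeZero K] {α : ℝ} {A : ℕ → ℕ} {m : Fin K → ℝ} {J : ℕ}
    {y : Fin N → Fin K → ℕ → ℝ} {s s' : ℕ} (h : Settled α A m J y s)
    (h' : Settled α A m J y s') : s = s' := by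
  have key : ∀ {s s' : ℕ}, Settled α A m J y s → Settled α A m J y s' → ¬ s < s' := by
    intro s s' h h' hlt
    have h1 := h.1
    rcases h'.2.2 with h2 | h2
    · omega
    · exact h.2.1 _ (by omega) h2
  exact le_antisymm (not_lt.mp (key h' h)) (not_lt.mp (key h h'))

lemma exists_settled {N K : ℕ} [NeZero K] {α : ℝ} {A : ℕ → ℕ} {m : Fin K → ℝ} {J : ℕ}
    {y : Fin N → Fin K → ℕ → ℝ} (h : ∃ s, J + 1 ≤ s ∧ ∀ j, s ≤ j → ¬ BadPhase α A m y j) :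
    ∃ s, Settled α A m J y s := by
  classical
  refine ⟨Nat.find h, (Nat.find_spec h).1, (Nat.find_spec h).2, ?_⟩
  by_contra! hcon
  have h1 := (Nat.find_spec h).1
  refine Nat.find_min h (m := Nat.find h - 1) (by omega) ⟨by omega, fun j hj => ?_⟩
  rcases hj.eq_or_lt with rfl | hj
  · exact hcon.2
  · exact (Nat.find_spec h).2 j (by omega)

lemma exists_spreadTime_eq {N : ℕ} [NeZero N] {w : Fin N → ℕ → Fin N} (h : spreadTime w ≠ ⊤) :
    ∃ n : ℕ, spreadTime w = n ∧ informed w n = Finset.univ := by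
  classical
  have hex : ∃ n, informed w n = Finset.univ := by
    by_contra! hcon
    exact h (by simp [spreadTime, hcon])
  refine ⟨Nat.find hex, le_antisymm (iInf₂_le (Nat.find hex) (Nat.find_spec hex)) ?_, Nat.find_spec hex⟩
  exact le_iInf₂ fun s hs => by exact_mod_cast Nat.find_min' hex hs

/-- The weights `b` and `g` stand for the indicators of bad and of settling phases, so every path
gets a bound that can be integrated term by term. -/
lemma IsRun.ofReal_regret_le {N K : ℕ} [NeZero N] [NeZero K] {α : ℝ} {A : ℕ → ℕ}
    {y : Fin N → Fin K → ℕ → ℝ} {z : Fin N → ℕ → Fin N} {I U L O : Fin N → ℕ → Fin K}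
    {m : Fin K → ℝ} {Δ : ℝ} (hα : 0 < α) (hA : Monotone A) (hA' : ∀ j, j < A j)
    (hconv : ∀ a b, 2 * A (a + b) ≤ A (2 * a) + A (2 * b))
    (h0 : ∀ l, 0 ≤ m l) (h1 : ∀ l, m l < 1) (hanti : Antitone m)
    (hm : ∀ l, l ≠ 0 → m l < m 0) (hΔ : 0 < Δ) (hΔ' : ∀ l, l ≠ 0 → Δ ≤ gap m l)
    (hrun : IsRun α A y z I U L O) {J : ℕ} (hlong : ∀ j, J < j → LongPhase N K α Δ A j)
    {b g : ℕ → ℝ≥0∞} (hb : ∀ j, BadPhase α A m y j → 1 ≤ b j)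
    (hg : ∀ s, Settled α A m J y s → 1 ≤ g s) (i : Fin N) (T : ℕ) :
    ENNReal.ofReal (regret m (I i) T)
      ≤ ENNReal.ofReal ((∑ l : Fin K with 1 ≤ l.val ∧ l.val ≤ stickySize N K + 1, 1 / gap m l)
          * (4 * α * Real.log T))
        + ((stickySize N K + 1 : ℕ) : ℝ≥0∞) + 2⁻¹ * (A (2 * J) : ℝ≥0∞)
        + ∑' j : {j : ℕ // J + 1 ≤ j}, b j * (A (2 * j) : ℝ≥0∞)
        + 2⁻¹ * ∑' s, g s * extendTop A (2 * spreadTime fun i r => z i (s + r)) := by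
  set D := (∑ l : Fin K with 1 ≤ l.val ∧ l.val ≤ stickySize N K + 1, 1 / gap m l)
          * (4 * α * Real.log T)
  set Sb := ∑' j : {j : ℕ // J + 1 ≤ j}, b j * (A (2 * j) : ℝ≥0∞) with hSb
  by_cases hset : ∃ s, J + 1 ≤ s ∧ ∀ j, s ≤ j → ¬ BadPhase α A m y j
  swap
  -- With bad phases arbitrarily late, infinitely many summands are at least `1`, and the bound is
  -- trivial.
  · have htop : Sb = ⊤ := by
      by_contra hne
      have hfin := ENNReal.finite_const_le_of_tsum_ne_top hne one_ne_zero
      obtain ⟨M, hM⟩ := (hfin.image Subtype.val).bddAbove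
      push Not at hset
      obtain ⟨j, hj, hbad⟩ := hset (max (J + 1) (M + 1)) (le_max_left _ _)
      have hj1 : J + 1 ≤ j := (le_max_left _ _).trans hj
      have hj2 : M + 1 ≤ j := (le_max_right _ _).trans hj
      have hle : 1 ≤ b j * (A (2 * j) : ℝ≥0∞) := by
        have h2 : (1 : ℝ≥0∞) ≤ A (2 * j) := by
          have := hA' (2 * j)
          exact_mod_cast (by omega : 1 ≤ A (2 * j))
        simpa using mul_le_mul' (hb j hbad) h2
      have := hM ⟨⟨j, hj1⟩, hle, rfl⟩
      simp only at this
      omega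
    rw [htop]
    simp
  obtain ⟨s, hs⟩ := exists_settled hset
  set τ := spreadTime fun i r => z i (s + r) with hτ
  have hterm : extendTop A (2 * τ)
      ≤ ∑' s, g s * extendTop A (2 * spreadTime fun i r => z i (s + r)) := by
    refine le_trans ?_ (ENNReal.le_tsum s)
    simpa using mul_le_mul' (hg s hs) (le_refl (extendTop A (2 * τ)))
  refine le_trans ?_ (add_le_add_right (mul_le_mul_right hterm _) _)
  by_cases hfin : τ = ⊤
  · rw [hfin]
    have : extendTop A (2 * ⊤) = ⊤ := by
      rw [ENat.mul_top (by norm_num)]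
      rfl
    rw [this, ENNReal.mul_top (by simp)]
    simp
  obtain ⟨n, hn, hinf⟩ := exists_spreadTime_eq hfin
  have hext : extendTop A (2 * τ) = (A (2 * n) : ℝ≥0∞) := by
    rw [hτ, hn]
    rfl
  rw [hext]
  have hs1 := hs.1
  have hreg := hrun.regret_le hα hA hA' h0 h1 hanti hm hΔ hΔ' (s := s) (by omega)
    (fun j hj => hlong j (by omega)) hs.2.1 hinf i T
  -- Either `s - 1 = J`, or phase `s - 1` is bad and contributes its own summand to `Sb`.
  have hAs : (A (2 * (s - 1)) : ℝ≥0∞) ≤ A (2 * J) + 2 * Sb := by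
    by_cases hsJ : s = J + 1
    · rw [hsJ]
      exact le_self_add
    · have hbad := hs.2.2.resolve_left hsJ
      refine le_trans ?_ le_add_self
      have : (A (2 * (s - 1)) : ℝ≥0∞) ≤ Sb := by
        refine le_trans ?_ (ENNReal.le_tsum (⟨s - 1, by omega⟩ : {j : ℕ // J + 1 ≤ j}))
        simpa using mul_le_mul' (hb _ hbad) (le_refl (A (2 * (s - 1)) : ℝ≥0∞))
      exact this.trans (by rw [two_mul]; exact le_self_add)
  have hhalf : (A (s - 1 + n) : ℝ≥0∞)
      ≤ 2⁻¹ * (A (2 * J) : ℝ≥0∞) + Sb + 2⁻¹ * (A (2 * n) : ℝ≥0∞) := by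
    have h2 : (2 : ℝ≥0∞) * A (s - 1 + n) ≤ A (2 * (s - 1)) + A (2 * n) := by
      exact_mod_cast hconv (s - 1) n
    have h22 : (2⁻¹ : ℝ≥0∞) * 2 = 1 := ENNReal.inv_mul_cancel (by simp) (by simp)
    calc (A (s - 1 + n) : ℝ≥0∞) = 2⁻¹ * (2 * A (s - 1 + n)) := by
          rw [← mul_assoc, h22, one_mul]
      _ ≤ 2⁻¹ * ((A (2 * J) + 2 * Sb) + A (2 * n)) := by gcongr; exact h2.trans (by gcongr)
      _ = _ := by rw [mul_add, mul_add, ← mul_assoc, h22, one_mul]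
  refine (ENNReal.ofReal_le_ofReal hreg).trans ?_
  refine (ENNReal.ofReal_add_le.trans (add_le_add_left ENNReal.ofReal_add_le _)).trans ?_
  have e : ENNReal.ofReal (stickySize N K + 1 : ℝ) = ((stickySize N K + 1 : ℕ) : ℝ≥0∞) := by
    rw [← ENNReal.ofReal_natCast]
    push_cast
    rfl
  rw [ENNReal.ofReal_natCast, e]
  calc _ ≤ (2⁻¹ * (A (2 * J) : ℝ≥0∞) + Sb + 2⁻¹ * (A (2 * n) : ℝ≥0∞)) + ENNReal.ofReal D
        + ((stickySize N K + 1 : ℕ) : ℝ≥0∞) := by gcongr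
    _ = _ := by ring

/-! ### Taking expectations -/

lemma measurable_deviates {N K : ℕ} [NeZero K] (α : ℝ) (m : Fin K → ℝ) (i : Fin N) (t : ℕ) :
    Measurable fun q : Fin N × Fin K × ℕ → ℝ => Deviates α m (fun l n => q (i, l, n)) t := by
  unfold Deviates
  refine Measurable.exists fun l => Measurable.exists fun n => ?_
  refine measurable_const.and (measurable_const.and ?_)
  refine measurableSet_setOfPred.mp (measurableSet_le measurable_const ?_)
  exact Finset.measurable_sum _ fun r _ =>
    ((measurable_pi_apply _).sub_const _).const_mul _

lemma measurable_badPhase {N K : ℕ} [NeZero K] (α : ℝ) (A : ℕ → ℕ) (m : Fin K → ℝ) (j : ℕ) :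
    Measurable fun q : Fin N × Fin K × ℕ → ℝ =>
      BadPhase α A m (fun i l n => q (i, l, n)) j := by
  unfold BadPhase
  exact Measurable.exists fun t => measurable_const.and (measurable_const.and
    (Measurable.exists fun i => measurable_deviates α m i t))

lemma measurable_settled {N K : ℕ} [NeZero K] (α : ℝ) (A : ℕ → ℕ) (m : Fin K → ℝ) (J s : ℕ) :
    Measurable fun q : Fin N × Fin K × ℕ → ℝ =>
      Settled α A m J (fun i l n => q (i, l, n)) s := by
  unfold Settled
  exact measurable_const.and ((Measurable.forall fun j => Measurable.imp measurable_const
    (measurable_badPhase α A m j).not).and (measurable_const.or (measurable_badPhase α A m _)))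

lemma measurable_regret {K : ℕ} [NeZero K] (m : Fin K → ℝ) {Ω : Type*} [MeasurableSpace Ω]
    {I : ℕ → Ω → Fin K} (hI : ∀ t, Measurable (I t)) (T : ℕ) :
    Measurable fun ω => regret m (fun t => I t ω) T := by
  unfold regret
  exact Finset.measurable_sum _ fun t _ =>
    (Measurable.of_discrete (f := fun l => m 0 - m l)).comp (hI t)

/-- Rumor spreading started at a random round that is independent of the calls takes as long, on
average, as if started in round `0`. -/
lemma tsum_lintegral_settled_le {N K : ℕ} [NeZero N] [NeZero K] (α : ℝ) (A : ℕ → ℕ)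
    {m : Fin K → ℝ} (J : ℕ) {P : Matrix (Fin N) (Fin N) ℝ} {Ω Ω' : Type*} [MeasurableSpace Ω]
    [MeasurableSpace Ω'] {μ : Measure Ω} {ν : Measure Ω'} [IsProbabilityMeasure μ]
    [IsProbabilityMeasure ν] {Y : Fin N → Fin K → ℕ → Ω → ℝ} (hY : IsRewardTable m μ Y)
    {Z : Fin N → ℕ → Ω → Fin N} {W : Fin N → ℕ → Ω' → Fin N}
    (hZ : IsCallTable P μ Z) (hW : IsCallTable P ν W)
    (hYZ : IndepFun (fun ω (p : Fin N × Fin K × ℕ) => Y p.1 p.2.1 p.2.2 ω)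
      (fun ω (q : Fin N × ℕ) => Z q.1 q.2 ω) μ) :
    ∑' s, ∫⁻ ω, {ω | Settled α A m J (fun i l n => Y i l n ω) s}.indicator 1 ω
        * extendTop A (2 * spreadTime fun i r => Z i (s + r) ω) ∂μ
      ≤ expectedSpread A ν W := by
  have hYm : Measurable fun ω (p : Fin N × Fin K × ℕ) => Y p.1 p.2.1 p.2.2 ω :=
    measurable_pi_lambda _ fun p => hY.measurable _ _ _
  have hZm : Measurable fun ω (q : Fin N × ℕ) => Z q.1 q.2 ω :=
    measurable_pi_lambda _ fun p => hZ.measurable _ _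
  have hset : ∀ s, MeasurableSet {q : Fin N × Fin K × ℕ → ℝ |
      Settled α A m J (fun i l n => q (i, l, n)) s} := fun s =>
    measurableSet_setOfPred.mpr (measurable_settled α A m J s)
  have hsetΩ : ∀ s, MeasurableSet {ω | Settled α A m J (fun i l n => Y i l n ω) s} := fun s =>
    hYm (hset s)
  have hterm : ∀ s, ∫⁻ ω, {ω | Settled α A m J (fun i l n => Y i l n ω) s}.indicator 1 ω
        * extendTop A (2 * spreadTime fun i r => Z i (s + r) ω) ∂μ
      = μ {ω | Settled α A m J (fun i l n => Y i l n ω) s} * expectedSpread A ν W := by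
    intro s
    have hφ : Measurable ({q : Fin N × Fin K × ℕ → ℝ |
      Settled α A m J (fun i l n => q (i, l, n)) s}.indicator
        (1 : (Fin N × Fin K × ℕ → ℝ) → ℝ≥0∞)) :=
      measurable_one.indicator (hset s)
    have hshift : Measurable fun (w : Fin N × ℕ → Fin N) (p : Fin N × ℕ) => w (p.1, s + p.2) :=
      measurable_pi_lambda _ fun p => measurable_pi_apply _
    have hF := measurable_extendTop_spreadTime (N := N) A
    -- Settling at the fixed phase `s` is an event of the rewards; the spreading time from `s` is a
    -- function of the calls.
    have hind := hYZ.comp hφ (hF.comp hshift)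
    have h := lintegral_mul_eq_lintegral_mul_lintegral_of_indepFun''
      (hφ.comp hYm).aemeasurable ((hF.comp hshift).comp hZm).aemeasurable hind
    refine Eq.trans h ?_
    congr 1
    · exact lintegral_indicator_one (hsetΩ s)
    · exact lintegral_shift_eq hZ hW s hF
  simp_rw [hterm]
  rw [ENNReal.tsum_mul_right, ← measure_iUnion _ hsetΩ]
  · exact (mul_le_mul_left prob_le_one _).trans_eq (one_mul _)
  · intro s s' hne
    rw [Function.onFun, Set.disjoint_left]
    exact fun ω h h' => hne (Settled.eq h h')

/-! ### Numerical constants of the bound -/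

lemma self_le_choose_two_mul {K c : ℕ} (hK : 2 ≤ K) (hc : 1 ≤ c) :
    (K : ℝ) ≤ (K.choose 2 : ℝ) * (c + 1) := by
  have h1 : (K : ℝ) ≥ 2 := by exact_mod_cast hK
  have h2 : (c : ℝ) ≥ 1 := by exact_mod_cast hc
  rw [Nat.cast_choose_two]
  nlinarith [mul_nonneg (show (0 : ℝ) ≤ K by linarith) (show (0 : ℝ) ≤ K - 2 by linarith),
    mul_nonneg (mul_nonneg (show (0 : ℝ) ≤ K by linarith) (show (0 : ℝ) ≤ K - 1 by linarith))
      (show (0 : ℝ) ≤ c - 1 by linarith)]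

lemma one_le_stickySize {N K : ℕ} [NeZero N] (hK : 1 ≤ K) : 1 ≤ stickySize N K := by
  unfold stickySize
  rw [Nat.one_le_ceil_iff]
  have h1 : (0 : ℝ) < K := by exact_mod_cast hK
  have h2 : (0 : ℝ) < N := by exact_mod_cast Nat.pos_of_ne_zero (NeZero.ne N)
  positivity

/-- Phases `J` and `J + 1` are long, hence have at least `c + 2` slots each, and `J + 1 ≤ 2 * J`. -/
lemma two_mul_stickySize_le {N K : ℕ} {α Δ : ℝ} (hα : 0 < α) {A : ℕ → ℕ} (hA : Monotone A) {J : ℕ} (hJ : 1 ≤ J)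
    (hlong : ∀ j, J ≤ j → LongPhase N K α Δ A j) :
    2 * (stickySize N K + 1) ≤ A (2 * J) := by
  have hstep : ∀ j, J ≤ j → prevTime A j + (stickySize N K + 2) ≤ A j := by
    intro j hj
    have h := hlong j hj
    unfold LongPhase at h
    have hlog : 0 ≤ Real.log (A j) := Real.log_natCast_nonneg _
    have h1 : (1 : ℝ) ≤ 1 + 4 * α * Real.log (A j) / Δ ^ 2 := by
      have : 0 ≤ 4 * α * Real.log (A j) / Δ ^ 2 := by positivity
      linarith
    have h2 := h1.trans h
    rw [le_div_iff₀ (by positivity)] at h2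
    have h3 : ((prevTime A j + (stickySize N K + 2) : ℕ) : ℝ) ≤ A j := by push_cast; linarith
    exact_mod_cast h3
  have h1 := hstep J le_rfl
  have h2 := hstep (J + 1) (by omega)
  have h3 : A (J + 1) ≤ A (2 * J) := hA (by omega)
  simp only [prevTime] at h2
  omega

/-- The threshold on `a` is chosen so that `M ≤ a ^ (2 * α - 6)`. The product is then at most `a ^
(-4)`, which is more than the cubic decay needed. -/
lemma badPhase_bound {α M a : ℝ} (hα : 3 < α) (hM : 1 ≤ M) (ha : 1 ≤ a)
    (h : M ^ (1 / (2 * α - 6)) < a) :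
    M / (2 * α - 2) * a ^ (2 - 2 * α) ≤ 2 / (2 * α - 3) * (a ^ 3)⁻¹ := by
  have ha0 : 0 < a := by linarith
  have hp : 0 < 2 * α - 6 := by linarith
  have h1 : M ≤ a ^ (2 * α - 6) := by
    have h2 := Real.rpow_le_rpow (by positivity) h.le hp.le
    rwa [← Real.rpow_mul (by linarith), one_div_mul_cancel hp.ne', Real.rpow_one] at h2
  have h3 : M * a ^ (2 - 2 * α) ≤ (a ^ 3)⁻¹ := by
    calc M * a ^ (2 - 2 * α) ≤ a ^ (2 * α - 6) * a ^ (2 - 2 * α) := by gcongr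
      _ = a ^ (-4 : ℝ) := by rw [← Real.rpow_add ha0]; ring_nf
      _ ≤ a ^ (-3 : ℝ) := Real.rpow_le_rpow_of_exponent_le ha (by norm_num)
      _ = (a ^ 3)⁻¹ := by rw [Real.rpow_neg ha0.le]; norm_cast
  have h4 : 1 / (2 * α - 2) ≤ 2 / (2 * α - 3) := by
    rw [div_le_div_iff₀ (by linarith) (by linarith)]
    linarith
  calc M / (2 * α - 2) * a ^ (2 - 2 * α) = 1 / (2 * α - 2) * (M * a ^ (2 - 2 * α)) := by ring
    _ ≤ 2 / (2 * α - 3) * (a ^ 3)⁻¹ := by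
      refine mul_le_mul h4 h3 ?_ ?_
      · have : 0 ≤ a ^ (2 - 2 * α) := by positivity
        nlinarith
      · have : 0 < 2 * α - 3 := by linarith
        positivity

/-- The probability of a deviation in phase `j`, once `A_{j-1}` is large. -/
lemma IsRewardTable.measure_badPhase_mul_le {N K : ℕ} [NeZero K] {m : Fin K → ℝ}
    (h0 : ∀ l, 0 ≤ m l) (h1 : ∀ l, m l < 1) {Ω : Type*} [MeasurableSpace Ω] {μ : Measure Ω}
    [IsProbabilityMeasure μ] {Y : Fin N → Fin K → ℕ → Ω → ℝ} (hY : IsRewardTable m μ Y)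
    {α : ℝ} (hα : 3 < α) {A : ℕ → ℕ} (hA : Monotone A) {M : ℝ} (hM1 : 1 ≤ M)
    (hNK : (N * K : ℝ) ≤ M) {j : ℕ} (hj : 1 ≤ j) (hAj : 1 ≤ A (j - 1))
    (hMA : M ^ (1 / (2 * α - 6)) < A (j - 1)) :
    μ {ω | BadPhase α A m (fun i l n => Y i l n ω) j} * (A (2 * j) : ℝ≥0∞)
      ≤ ENNReal.ofReal (2 / (2 * α - 3)) *
        ((A (2 * j + 1) : ℝ≥0∞) / (A (j - 1) : ℝ≥0∞) ^ 3) := by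
  obtain ⟨k, rfl⟩ : ∃ k, j = k + 1 := ⟨j - 1, by omega⟩
  simp only [Nat.add_sub_cancel] at hAj hMA ⊢
  have hk1 : (1 : ℝ) ≤ A k := by exact_mod_cast hAj
  have hk0 : (0 : ℝ) < A k := by linarith
  have h1 : μ {ω | BadPhase α A m (fun i l n => Y i l n ω) (k + 1)}
      ≤ ENNReal.ofReal (2 / (2 * α - 3)) * ((A k : ℝ≥0∞) ^ 3)⁻¹ := by
    refine (hY.measure_badPhase_le h0 h1 hα (A := A) (j := k + 1) hAj).trans ?_
    have h2 := badPhase_bound hα hM1 hk1 hMA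
    have h3 : (N * K / (2 * α - 2) * (A k : ℝ) ^ (2 - 2 * α) : ℝ)
        ≤ 2 / (2 * α - 3) * ((A k : ℝ) ^ 3)⁻¹ := by
      refine le_trans ?_ h2
      have : 0 < 2 * α - 2 := by linarith
      gcongr
    refine (ENNReal.ofReal_le_ofReal h3).trans_eq ?_
    rw [ENNReal.ofReal_mul (div_nonneg zero_le_two (by linarith)),
      ENNReal.ofReal_inv_of_pos (by positivity), ENNReal.ofReal_pow hk0.le,
      ENNReal.ofReal_natCast]
  have h4 : (A (2 * (k + 1)) : ℝ≥0∞) ≤ A (2 * (k + 1) + 1) := by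
    exact_mod_cast hA (Nat.le_succ _)
  refine (mul_le_mul' h1 h4).trans_eq ?_
  rw [ENNReal.div_eq_inv_mul, mul_assoc]

/-! ### Integration of the pathwise bound -/

lemma lintegral_le_of_ae_le_tsum {Ω ι κ : Type*} [Countable ι] [Countable κ] [MeasurableSpace Ω]
    {μ : Measure Ω} [IsProbabilityMeasure μ] {f : Ω → ℝ≥0∞} {C a : ℝ≥0∞} {E : ι → Set Ω}
    {w : ι → ℝ≥0∞} {G : κ → Set Ω} {X : κ → Ω → ℝ≥0∞}
    (h : ∀ᵐ ω ∂μ, f ω ≤ C + ∑' j, (E j).indicator 1 ω * w j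
      + a * ∑' s, (G s).indicator 1 ω * X s ω)
    (hE : ∀ j, MeasurableSet (E j)) (hG : ∀ s, MeasurableSet (G s)) (hX : ∀ s, Measurable (X s)) :
    ∫⁻ ω, f ω ∂μ ≤ C + ∑' j, μ (E j) * w j
      + a * ∑' s, ∫⁻ ω, (G s).indicator 1 ω * X s ω ∂μ := by
  have hind : ∀ {s : Set Ω}, MeasurableSet s → Measurable (s.indicator (1 : Ω → ℝ≥0∞)) :=
    fun hs => measurable_one.indicator hs
  have hm1 : ∀ j, Measurable fun ω => (E j).indicator (1 : Ω → ℝ≥0∞) ω * w j :=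
    fun j => (hind (hE j)).mul_const _
  have hm2 : ∀ s, Measurable fun ω => (G s).indicator (1 : Ω → ℝ≥0∞) ω * X s ω :=
    fun s => (hind (hG s)).mul (hX s)
  refine (lintegral_mono_ae h).trans (le_of_eq ?_)
  rw [lintegral_add_right _ ((Measurable.tsum hm2).const_mul _),
    lintegral_add_right _ (Measurable.tsum hm1), lintegral_const, measure_univ, mul_one,
    lintegral_const_mul _ (Measurable.tsum hm2), lintegral_tsum fun s => (hm2 s).aemeasurable,
    lintegral_tsum fun j => (hm1 j).aemeasurable]
  simp_rw [lintegral_mul_const _ (hind (hE _)), lintegral_indicator_one (hE _)]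

lemma measurable_extendTop_shift {N : ℕ} [NeZero N] (A : ℕ → ℕ) {Ω : Type*} [MeasurableSpace Ω]
    {Z : Fin N → ℕ → Ω → Fin N} (hZ : ∀ i s, Measurable (Z i s)) (s : ℕ) :
    Measurable fun ω => extendTop A (2 * spreadTime fun i r => Z i (s + r) ω) := by
  have hm : Measurable fun ω (p : Fin N × ℕ) => Z p.1 (s + p.2) ω :=
    measurable_pi_lambda _ fun p => hZ _ _
  have h := (measurable_extendTop_spreadTime A).comp hm
  exact h

lemma lintegral_regret_le {N K : ℕ} [NeZero N] [NeZero K] {α : ℝ} {A : ℕ → ℕ}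
    {m : Fin K → ℝ} {Δ : ℝ} (hα : 0 < α) (hA : Monotone A) (hA' : ∀ j, j < A j)
    (hconv : ∀ a b, 2 * A (a + b) ≤ A (2 * a) + A (2 * b))
    (h0 : ∀ l, 0 ≤ m l) (h1 : ∀ l, m l < 1) (hanti : Antitone m)
    (hm : ∀ l, l ≠ 0 → m l < m 0) (hΔ : 0 < Δ) (hΔ' : ∀ l, l ≠ 0 → Δ ≤ gap m l)
    {J : ℕ} (hlong : ∀ j, J < j → LongPhase N K α Δ A j)
    {P : Matrix (Fin N) (Fin N) ℝ} {Ω Ω' : Type*} [MeasurableSpace Ω]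
    [MeasurableSpace Ω'] {μ : Measure Ω} {ν : Measure Ω'} [IsProbabilityMeasure μ]
    [IsProbabilityMeasure ν] {Y : Fin N → Fin K → ℕ → Ω → ℝ} (hY : IsRewardTable m μ Y)
    {Z : Fin N → ℕ → Ω → Fin N} {W : Fin N → ℕ → Ω' → Fin N}
    (hZ : IsCallTable P μ Z) (hW : IsCallTable P ν W)
    (hYZ : IndepFun (fun ω (p : Fin N × Fin K × ℕ) => Y p.1 p.2.1 p.2.2 ω)
      (fun ω (q : Fin N × ℕ) => Z q.1 q.2 ω) μ)
    {I : Fin N → ℕ → Ω → Fin K}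
    (hrun : ∀ᵐ ω ∂μ, ∃ U L O : Fin N → ℕ → Fin K,
      IsRun α A (fun i l n => Y i l n ω) (fun i j => Z i j ω) (fun i t => I i t ω) U L O)
    (i : Fin N) (T : ℕ) :
    ∫⁻ ω, ENNReal.ofReal (regret m (fun t => I i t ω) T) ∂μ
      ≤ ENNReal.ofReal ((∑ l : Fin K with 1 ≤ l.val ∧ l.val ≤ stickySize N K + 1, 1 / gap m l)
          * (4 * α * Real.log T))
        + ((stickySize N K + 1 : ℕ) : ℝ≥0∞) + 2⁻¹ * (A (2 * J) : ℝ≥0∞)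
        + ∑' j : {j : ℕ // J + 1 ≤ j},
          μ {ω | BadPhase α A m (fun i l n => Y i l n ω) j} * (A (2 * j) : ℝ≥0∞)
        + expectedSpread A ν W := by
  set bad : ℕ → Set Ω := fun j => {ω | BadPhase α A m (fun i l n => Y i l n ω) j} with hbad
  set stl : ℕ → Set Ω := fun s => {ω | Settled α A m J (fun i l n => Y i l n ω) s} with hstl
  have hYm : Measurable fun ω (p : Fin N × Fin K × ℕ) => Y p.1 p.2.1 p.2.2 ω :=
    measurable_pi_lambda _ fun p => hY.measurable _ _ _
  have hbadm : ∀ j, MeasurableSet (bad j) := fun j =>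
    hYm (measurableSet_setOfPred.mpr (measurable_badPhase α A m j))
  have hstlm : ∀ s, MeasurableSet (stl s) := fun s =>
    hYm (measurableSet_setOfPred.mpr (measurable_settled α A m J s))
  set spr : ℕ → Ω → ℝ≥0∞ := fun s ω =>
    extendTop A (2 * spreadTime fun i r => Z i (s + r) ω) with hspr
  have hsprm : ∀ s, Measurable (spr s) := measurable_extendTop_shift A hZ.measurable
  have hpath : ∀ᵐ ω ∂μ, ENNReal.ofReal (regret m (fun t => I i t ω) T)
      ≤ ENNReal.ofReal ((∑ l : Fin K with 1 ≤ l.val ∧ l.val ≤ stickySize N K + 1, 1 / gap m l)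
          * (4 * α * Real.log T)) + ((stickySize N K + 1 : ℕ) : ℝ≥0∞) + 2⁻¹ * (A (2 * J) : ℝ≥0∞)
        + ∑' j : {j : ℕ // J + 1 ≤ j}, (bad j).indicator 1 ω * (A (2 * j) : ℝ≥0∞)
        + 2⁻¹ * ∑' s, (stl s).indicator 1 ω * spr s ω := by
    filter_upwards [hrun] with ω hω
    obtain ⟨U, L, O, hω⟩ := hω
    refine hω.ofReal_regret_le (J := J) hα hA hA' hconv h0 h1 hanti
      hm hΔ hΔ' hlong (b := fun j => (bad j).indicator 1 ω)
      (g := fun s => (stl s).indicator 1 ω) (fun j hj => ?_) (fun s hs => ?_) i T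
    · exact (Set.indicator_of_mem (s := bad j) hj 1).ge
    · exact (Set.indicator_of_mem (s := stl s) hs 1).ge
  have hspread : 2⁻¹ * ∑' s, ∫⁻ ω, (stl s).indicator 1 ω * spr s ω ∂μ
      ≤ expectedSpread A ν W := by
    refine (mul_le_mul_right (tsum_lintegral_settled_le α A J hY hZ hW hYZ) _).trans ?_
    -- The factor `1 / 2` from convexity is given away here.
    exact (mul_le_mul_left (by simp) _).trans_eq (one_mul _)
  exact (lintegral_le_of_ae_le_tsum hpath (fun j => hbadm j) hstlm hsprm).trans
    (add_le_add_right hspread _)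

end GosInE

/-! ### Assembly with the stated constants -/

theorem theorem1 {N K : ℕ} [NeZero N] [NeZero K] (hN : 2 ≤ N) (hK : 2 ≤ K)
    -- the arm means, sorted, with a unique best arm
    (m : Fin K → ℝ) (hm_nonneg : ∀ l, 0 ≤ m l) (hm_lt : ∀ l, m l < 1) (hm_anti : Antitone m)
    (hm_best : ∀ l, l ≠ 0 → m l < m 0)
    -- the gossip matrix
    (P : Matrix (Fin N) (Fin N) ℝ) (hP : GosInE.IsGossipMatrix P) (hP_irr : GosInE.IsIrreducible P)
    -- the parameters of the algorithm
    (α : ℝ) (hα : 3 < α) (ε : ℝ) (hε : 0 < ε)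
    (B : ℕ → ℝ) (hB_nonneg : ∀ t, 0 ≤ B t) (hB_mono : Monotone B)
    (hB : GosInE.BudgetAssumption B ε)
    -- the system of agents, all of them running the algorithm
    {Ω : Type*} [MeasurableSpace Ω] (μ : Measure Ω) [IsProbabilityMeasure μ]
    (Y : Fin N → Fin K → ℕ → Ω → ℝ) (hY : GosInE.IsRewardTable m μ Y)
    (Z : Fin N → ℕ → Ω → Fin N) (hZ : GosInE.IsCallTable P μ Z)
    (hYZ : IndepFun (fun ω (p : Fin N × Fin K × ℕ) => Y p.1 p.2.1 p.2.2 ω)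
      (fun ω (q : Fin N × ℕ) => Z q.1 q.2 ω) μ)
    (I : Fin N → ℕ → Ω → Fin K) (hI : ∀ i t, Measurable (I i t))
    (hrun : ∀ᵐ ω ∂μ, ∃ U L O : Fin N → ℕ → Fin K,
      GosInE.IsRun α (GosInE.commTime B ε) (fun i l n => Y i l n ω) (fun i j => Z i j ω)
        (fun i t => I i t ω) U L O)
    -- a separate pull rumor process on the gossip matrix
    {Ω' : Type*} [MeasurableSpace Ω'] (ν : Measure Ω') [IsProbabilityMeasure ν]
    (W : Fin N → ℕ → Ω' → Fin N) (hW : GosInE.IsCallTable P ν W)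
    (i : Fin N) (T : ℕ) :
    ENNReal.ofReal (∫ ω, GosInE.regret m (fun t => I i t ω) T ∂μ)
      ≤ ENNReal.ofReal
          ((∑ l : Fin K with 1 ≤ l.val ∧ l.val ≤ GosInE.stickySize N K + 1, 1 / GosInE.gap m l)
            * (4 * α * Real.log T) + (K : ℝ) / 4)
        + GosInE.gConst α (GosInE.commTime B ε)
            (GosInE.jStar N K α (GosInE.gap m 1) (GosInE.commTime B ε))
        + GosInE.expectedSpread (GosInE.commTime B ε) ν W := by
  open GosInE in
  set A := commTime B ε with hAdef
  set c := stickySize N K with hc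
  have hA : Monotone A := hB.monotone hε.le
  have hA' : ∀ j, j < A j := lt_commTime B hε.le
  have hval1 : (1 : Fin K).val = 1 := by
    obtain ⟨K, rfl⟩ : ∃ K', K = K' + 2 := ⟨K - 2, by omega⟩
    rfl
  have h10 : (1 : Fin K) ≠ 0 := fun h => by
    have := congrArg Fin.val h
    rw [hval1, Fin.val_zero] at this
    omega
  set Δ := gap m 1 with hΔdef
  have hΔ : 0 < Δ := gap_pos hm_best h10
  have hΔ' : ∀ l, l ≠ 0 → Δ ≤ gap m l := fun l hl => by
    have h1l : (1 : Fin K) ≤ l := by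
      rw [Fin.le_iff_val_le_val, hval1]
      exact Nat.one_le_iff_ne_zero.mpr fun h => hl (Fin.ext (by rw [h, Fin.val_zero]))
    have := hm_anti h1l
    simp only [hΔdef, gap]
    linarith
  have hα0 : 0 < α := by linarith
  set M : ℝ := (N : ℝ) * (K.choose 2 : ℝ) * ((c : ℝ) + 1) with hM
  obtain ⟨J, hJst, hJinv, hlong⟩ : ∃ J, jStar N K α Δ A = 2 * J ∧
      invTime A (M ^ (1 / (2 * α - 6))) < J ∧ ∀ j, J ≤ j → LongPhase N K α Δ A j := by
    refine ⟨_, rfl, lt_of_lt_of_le (Nat.lt_succ_self _) (le_max_left _ _), fun j hj => ?_⟩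
    exact Nat.sInf_mem (hB.exists_forall_longPhase hε hB_nonneg N K α Δ) j
      ((le_max_right _ _).trans hj)
  have hJ1 : 1 ≤ J := by omega
  have hNK : (N * K : ℝ) ≤ M := by
    rw [hM, mul_assoc]
    exact mul_le_mul_of_nonneg_left (self_le_choose_two_mul hK (one_le_stickySize (by omega)))
      (Nat.cast_nonneg N)
  have hM1 : 1 ≤ M := by
    have h1 : (2 : ℝ) ≤ N := by exact_mod_cast hN
    have h2 : (2 : ℝ) ≤ K := by exact_mod_cast hK
    nlinarith
  set D := (∑ l : Fin K with 1 ≤ l.val ∧ l.val ≤ c + 1, 1 / gap m l) * (4 * α * Real.log T)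
  have hreg : ENNReal.ofReal (∫ ω, regret m (fun t => I i t ω) T ∂μ)
      = ∫⁻ ω, ENNReal.ofReal (regret m (fun t => I i t ω) T) ∂μ := by
    refine ofReal_integral_eq_lintegral_ofReal ?_
      (Filter.Eventually.of_forall fun ω => regret_nonneg hm_anti _ T)
    refine Integrable.of_mem_Icc 0 T (measurable_regret m (hI i) T).aemeasurable
      (Filter.Eventually.of_forall fun ω => ⟨regret_nonneg hm_anti _ T, ?_⟩)
    exact regret_le (gap_le_one hm_nonneg hm_lt) _ T
  have hbadsum : ∑' j : {j : ℕ // J + 1 ≤ j},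
        μ {ω | BadPhase α A m (fun i l n => Y i l n ω) j} * (A (2 * j) : ℝ≥0∞)
      ≤ ENNReal.ofReal (2 / (2 * α - 3)) *
        ∑' l : {l : ℕ // 1 ≤ l ∧ jStar N K α Δ A / 2 ≤ l + 1},
          (A (2 * l.1 + 1) : ℝ≥0∞) / (A (l.1 - 1) : ℝ≥0∞) ^ 3 := by
    -- For `j ≥ J + 1` one has `j - 1 ≥ J`, beyond the inverse-time threshold, so `A (j - 1)` is
    -- large enough for the tail estimate.
    refine (ENNReal.tsum_le_tsum fun j =>
      hY.measure_badPhase_mul_le hm_nonneg hm_lt hα hA hM1 hNK (le_trans (by omega) j.2)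
        (Nat.one_le_of_lt (hA' _))
        (lt_invTime hA' (lt_of_lt_of_le hJinv (Nat.le_sub_one_of_lt j.2)))).trans ?_
    rw [ENNReal.tsum_mul_left]
    refine mul_le_mul_right ?_ _
    -- The sum in `gConst` starts no later than at `J + 1`, so it only has additional nonnegative
    -- terms.
    exact ENNReal.tsum_comp_le_tsum_of_injective
      (f := fun j : {j : ℕ // J + 1 ≤ j} =>
        (⟨j.1, by have := j.2; rw [hJst]; omega⟩ :
          {l : ℕ // 1 ≤ l ∧ jStar N K α Δ A / 2 ≤ l + 1}))
      (fun a b hab => Subtype.ext (by simpa using hab))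
      (fun l => (A (2 * l.1 + 1) : ℝ≥0∞) / (A (l.1 - 1) : ℝ≥0∞) ^ 3)
  -- Only half of `A (2 * J)` was spent on the early phases; the other half pays the extra `c + 1`,
  -- so that `K / 4` remains as slack.
  have hslack : ((c + 1 : ℕ) : ℝ≥0∞) + 2⁻¹ * (A (2 * J) : ℝ≥0∞) ≤ A (2 * J) := by
    have h1 : ((2 : ℝ≥0∞)) * ((c + 1 : ℕ) : ℝ≥0∞) ≤ A (2 * J) := by
      exact_mod_cast two_mul_stickySize_le hα0 hA hJ1 hlong
    have h2 : ((c + 1 : ℕ) : ℝ≥0∞) ≤ 2⁻¹ * (A (2 * J) : ℝ≥0∞) := by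
      rw [← ENNReal.div_eq_inv_mul, ENNReal.le_div_iff_mul_le (by simp) (by simp), mul_comm]
      exact h1
    refine (add_le_add_left h2 _).trans_eq ?_
    rw [← add_mul, ENNReal.inv_two_add_inv_two, one_mul]
  rw [hreg]
  refine (lintegral_regret_le hα0 hA hA' hB.two_mul_add_le hm_nonneg hm_lt hm_anti hm_best hΔ hΔ'
    (fun j hj => hlong j hj.le) hY hZ hW hYZ hrun i T).trans ?_
  refine add_le_add_left ?_ _
  unfold gConst
  rw [hJst, ← add_assoc, add_assoc (ENNReal.ofReal D)]
  rw [hJst] at hbadsum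
  refine add_le_add (add_le_add (ENNReal.ofReal_le_ofReal ?_) hslack) hbadsum
  have : (0 : ℝ) ≤ K / 4 := by positivity
  linarith
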